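/- **Theorem.** Let $\zeta=e^{2\pi i/3}$ and let $\mathcal G_3=(\mathbb C\times\mathbb R)/\Gamma$, where $\Gamma$ is the group of Euclidean motions generated by $(u,t)\mapsto(u+1,t)$, $(u,t)\mapsto(u+\zeta,t)$ and $(u,t)\mapsto(\zeta u,t+1)$. Let $\mathcal G_1=(\mathbb R/\mathbb Z)^3$ be the 3-torus. For a positive integer $n$ put $$\theta(n)=\bigl|\{(p,q)\in\mathbb Z^2 : p>0,\ q\ge 0,\ p^2+pq+q^2=n\}\bigr|,\qquad \sigma_1(n)=\sum_{k\mid n}k,\qquad \omega(n)=\sum_{k\mid n}k\,\sigma_1(k),$$ and let every expression $\omega(\frac nd)$ and $\sum_{k\mid \frac nd}\theta(k)$ be $0$ when $\frac nd$ is not an integer. Two coverings $p_i:\mathcal N_i\to\mathcal G_3$ ($i=1,2$) are equivalent if there is a homeomorphism $h:\mathcal N_1\to\mathcal N_2$ with $p_1=p_2\circ h$. For groups $H,G$ let $c_{H,G}(n)$ be the number of conjugacy classes of subgroups of index $n$ in $G$ that are isomorphic to $H$. Let $n\ge 1$ and let $\mathcal N\to\mathcal G_3$ be an $n$-fold covering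 with $\mathcal N$ connected. If $3\nmid n$, then $\mathcal N$ is homeomorphic to $\mathcal G_3$. If $3\mid n$, then $\mathcal N$ is homeomorphic to $\mathcal G_3$ or to $\mathcal G_1$. The number of equivalence classes of connected $n$-fold coverings of $\mathcal G_3$ with total space homeomorphic to $\mathcal G_3$ is finite and equals $$c_{\pi_1(\mathcal G_3),\pi_1(\mathcal G_3)}(n)=\sum_{k\mid n}\theta(k)+\sum_{k\mid\frac n3}\theta(k)-2\sum_{k\mid\frac n9}\theta(k),$$ and the number of those with total space homeomorphic to $\mathcal G_1$ is finite and equals $$c_{\mathbb Z^3,\pi_1(\mathcal G_3)}(n)=\frac13\Bigl(\omega\bigl(\tfrac n3\bigr)+2\sum_{k\mid\frac n3}\theta(k)+4\sum_{k\mid\frac n9}\theta(k)\Bigr).$$ -/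

import Mathlib

universe u v w

noncomputable section

/-! ### Arithmetic functions -/

/-- `θ(n)`, the number of pairs of integers `(p, q)` with `p > 0`, `q ≥ 0` and
`p² + p q + q² = n`. -/
def theta (n : ℕ) : ℕ :=
  Set.ncard {v : ℤ × ℤ | 0 < v.1 ∧ 0 ≤ v.2 ∧ v.1 ^ 2 + v.1 * v.2 + v.2 ^ 2 = (n : ℤ)}

/-- `∑_{k ∣ n} θ(k)`. -/
def sumTheta (n : ℕ) : ℕ := ∑ k ∈ n.divisors, theta k

/-- `σ₁(n) = ∑_{k ∣ n} k`. -/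
def sigmaOne (n : ℕ) : ℕ := ∑ k ∈ n.divisors, k

/-- `ω(n) = ∑_{k ∣ n} k σ₁(k)`. -/
def omegaFun (n : ℕ) : ℕ := ∑ k ∈ n.divisors, k * sigmaOne k

/-- The value `f (n / d)`, with the convention that it is `0` if `n / d` is not an integer. -/
def atQuot (f : ℕ → ℕ) (n d : ℕ) : ℕ := if d ∣ n then f (n / d) else 0

/-! ### The manifolds -/

/-- The primitive cube root of unity `exp (2 π i / 3)`, as an element of the unit circle. -/
def cubeRoot : Circle := Circle.exp (2 * Real.pi / 3)

/-- The translation `(u, t) ↦ (u + 1, t)` of `ℂ × ℝ`. -/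
def isoX : (ℂ × ℝ) ≃ₜ (ℂ × ℝ) := Homeomorph.addRight ((1, 0) : ℂ × ℝ)

/-- The translation `(u, t) ↦ (u + exp (2 π i / 3), t)` of `ℂ × ℝ`. -/
def isoY : (ℂ × ℝ) ≃ₜ (ℂ × ℝ) := Homeomorph.addRight (((cubeRoot : ℂ), 0) : ℂ × ℝ)

/-- The screw motion `(u, t) ↦ (exp (2 π i / 3) u, t + 1)` of `ℂ × ℝ`. -/
def isoZ : (ℂ × ℝ) ≃ₜ (ℂ × ℝ) :=
  (rotation cubeRoot).toHomeomorph.prodCongr (Homeomorph.addRight (1 : ℝ))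

/-- The crystallographic group generated by the three Euclidean motions above. -/
def tricosmGroup : Subgroup ((ℂ × ℝ) ≃ₜ (ℂ × ℝ)) := Subgroup.closure {isoX, isoY, isoZ}

/-- Two points are related if a motion in `tricosmGroup` carries the first to the second. -/
def tricosmSetoid : Setoid (ℂ × ℝ) where
  r v w := ∃ g ∈ tricosmGroup, g v = w
  iseqv :=
    { refl := fun _ => ⟨1, one_mem _, rfl⟩
      symm := by
        rintro v _ ⟨g, hg, rfl⟩
        exact ⟨g⁻¹, inv_mem hg, g.symm_apply_apply v⟩
      trans := by
        rintro v _ _ ⟨g, hg, rfl⟩ ⟨h, hh, rfl⟩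
        exact ⟨h * g, mul_mem hh hg, rfl⟩ }

/-- The closed orientable flat 3-manifold `𝒢₃` (the tricosm): Euclidean 3-space modulo
`tricosmGroup`, with the quotient topology. -/
abbrev Tricosm : Type := Quotient tricosmSetoid

/-- The manifold `𝒢₁`: the 3-torus `(ℝ/ℤ)³`. -/
abbrev Torus3 : Type := Fin 3 → UnitAddCircle

/-! ### Coverings -/

/-- An `n`-fold covering of `X` with connected total space. -/
structure NFoldCovering (X : Type v) [TopologicalSpace X] (n : ℕ) where
  /-- The total space. -/
  Total : Type u
  [top : TopologicalSpace Total]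
  [conn : ConnectedSpace Total]
  /-- The projection. -/
  proj : Total → X
  isCoveringMap : IsCoveringMap proj
  card_fiber : ∀ x : X, Nat.card (proj ⁻¹' {x}) = n

attribute [instance] NFoldCovering.top NFoldCovering.conn

/-- Two coverings are equivalent if a homeomorphism of the total spaces commutes with the
projections. -/
def NFoldCovering.Equivalent {X : Type v} [TopologicalSpace X] {n : ℕ}
    (c₁ c₂ : NFoldCovering.{u} X n) : Prop :=
  ∃ h : c₁.Total ≃ₜ c₂.Total, c₁.proj = c₂.proj ∘ h

/-- Equivalence of coverings, on the `n`-fold coverings of `X` whose total space is homeomorphic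
to `M`. -/
def coveringSetoid (X : Type v) [TopologicalSpace X] (n : ℕ) (M : Type w) [TopologicalSpace M] :
    Setoid {c : NFoldCovering.{u} X n // Nonempty (c.Total ≃ₜ M)} where
  r c₁ c₂ := c₁.1.Equivalent c₂.1
  iseqv :=
    { refl := fun c => ⟨Homeomorph.refl c.1.Total, rfl⟩
      symm := by
        rintro c₁ c₂ ⟨h, e⟩
        refine ⟨h.symm, ?_⟩
        rw [e]
        funext y
        simp
      trans := by
        rintro c₁ c₂ c₃ ⟨h, e⟩ ⟨h', e'⟩
        refine ⟨h.trans h', ?_⟩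
        rw [e, e']
        rfl }

/-- The equivalence classes of `n`-fold coverings of `X` whose total space is homeomorphic
to `M`. -/
def CoveringClasses (X : Type v) [TopologicalSpace X] (n : ℕ) (M : Type w) [TopologicalSpace M] :=
  Quotient (coveringSetoid.{u} X n M)

/-! ### Conjugacy classes of subgroups -/

/-- The conjugacy class of a subgroup. -/
def subgroupConjClass {G : Type v} [Group G] (S : Subgroup G) : Set (Subgroup G) :=
  {T | ∃ g : G, T = S.map (MulAut.conj g).toMonoidHom}

/-- The set of conjugacy classes of subgroups of index `n` in `G` that are isomorphic to `H`;
its cardinality is `c_{H,G}(n)`. -/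
def conjClassesOfType (H : Type w) [Group H] (G : Type v) [Group G] (n : ℕ) :
    Set (Set (Subgroup G)) :=
  {O | ∃ S : Subgroup G, S.index = n ∧ Nonempty (S ≃* H) ∧ O = subgroupConjClass S}

end

/-! The group Γ is `ℤ[ζ] ⋊ ℤ`, the generator of `ℤ` acting as multiplication by `ζ`. Every
nontrivial element moves every point of `ℂ × ℝ` by at least 1, so `ℂ × ℝ → 𝒢₃` is the quotient
covering of a simply connected space. Equivalence classes of connected `n`-fold coverings are
therefore conjugacy classes of subgroups `S` of index `n`, with total space the orbit space of `S`.

Such an `S` amounts to three data: the generator `d > 0` of its image in `ℤ`, the sublattice `L = S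
∩ ℤ[ζ]`, which has index `n / d` and is stable under `ζ ^ d`, and the coset of those `u` modulo `L`
with `(u, d) ∈ S` (`index_eq_degree_mul`, `nonempty_equiv_sigma`). If `3 ∣ d`, then `S` acts as a
lattice of translations and the quotient is the torus (`of_three_dvd_degree`). If `3 ∤ d`, then `L`
is an ideal `(α)` and an affine map conjugates Γ onto `S`, so the quotient is again `𝒢₃`
(`of_not_three_dvd_degree`). Commutativity tells the two cases apart.

Count for `3 ∤ d`: conjugation replaces `u` by `ζ ^ j u + (1 - ζ ^ d) b`. Classes of degree `d` are
thus pairs of an ideal `L` of norm `n / d` and an element of `ℤ[ζ] / (L + (1 - ζ))`, a group of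
order 3 or 1 according to whether `3 ∣ n / d`. Since `ℤ[ζ]` is principal, there are `θ(m)` ideals of
norm `m` (`nonempty_sector_equiv`). Since 3 ramifies, `θ(3m) = θ(m)`.

Count for `3 ∣ d`: every sublattice and every coset occur, which gives `ω(n / 3)` subgroups.
Conjugation by `g` depends only on the degree of `g` modulo 3, so classes are the orbits of a
permutation whose cube is trivial. Its fixed points have `L` an ideal and `(1 - ζ) u ∈ L`, and
Burnside's lemma yields the factor 1/3. -/

open Topology in
theorem exists_homeomorph_of_isQuotientMap {E X Y : Type*} [TopologicalSpace E]
    [TopologicalSpace X] [TopologicalSpace Y] {f : E → X} {g : E → Y} (hf : IsQuotientMap f)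
    (hg : IsQuotientMap g) (hfg : ∀ a b, f a = f b ↔ g a = g b) :
    ∃ h : X ≃ₜ Y, ∀ e, h (f e) = g e := by
  let F : C(X, Y) := IsQuotientMap.lift (f := ⟨f, hf.continuous⟩) hf ⟨g, hg.continuous⟩
    fun a b hab => (hfg a b).1 hab
  let K : C(Y, X) := IsQuotientMap.lift (f := ⟨g, hg.continuous⟩) hg ⟨f, hf.continuous⟩
    fun a b hab => (hfg a b).2 hab
  have hF : ∀ e, F (f e) = g e := fun e =>
    DFunLike.congr_fun (IsQuotientMap.lift_comp (f := ⟨f, hf.continuous⟩) hf ⟨g, hg.continuous⟩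
      fun a b hab => (hfg a b).1 hab) e
  have hK : ∀ e, K (g e) = f e := fun e =>
    DFunLike.congr_fun (IsQuotientMap.lift_comp (f := ⟨g, hg.continuous⟩) hg ⟨f, hf.continuous⟩
      fun a b hab => (hfg a b).2 hab) e
  refine ⟨{ toFun := F, invFun := K, left_inv := ?_, right_inv := ?_,
            continuous_toFun := F.continuous, continuous_invFun := K.continuous }, hF⟩
  · intro x
    obtain ⟨e, rfl⟩ := hf.surjective x
    rw [hF, hK]
  · intro x
    obtain ⟨e, rfl⟩ := hg.surjective x
    rw [hK, hF]

/-! ### Classification of connected coverings of an orbit space by subgroups. -/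

namespace IsQuotientCoveringMap

open Topology

variable {E : Type w} {X : Type v} [TopologicalSpace E] [TopologicalSpace X] {p : E → X}
  {G : Type*} [Group G] [MulAction G E]

theorem mk_subgroup (hp : IsQuotientCoveringMap p G) (H : Subgroup G) :
    IsQuotientCoveringMap (Quotient.mk (MulAction.orbitRel H E)) H where
  __ := isQuotientMap_quotient_mk'
  continuous_const_smul g := hp.continuous_const_smul (g : G)
  apply_eq_iff_mem_orbit := Quotient.eq''
  disjoint e := by
    obtain ⟨U, hU, hd⟩ := hp.disjoint e
    exact ⟨U, hU, fun g hg => Subtype.ext (hd g hg)⟩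

omit [TopologicalSpace E] in
theorem mk_eq_mk_iff {H : Subgroup G} {a b : E} :
    Quotient.mk (MulAction.orbitRel H E) a = Quotient.mk (MulAction.orbitRel H E) b ↔
      ∃ g ∈ H, g • b = a := by
  rw [Quotient.eq, MulAction.orbitRel_apply, MulAction.mem_orbit_iff]
  exact ⟨fun ⟨g, hg⟩ => ⟨g, g.2, hg⟩, fun ⟨g, hg, h⟩ => ⟨⟨g, hg⟩, h⟩⟩

/-- The projection `E / H → X` for a subgroup `H` of the group of a quotient covering
`E → X`. -/
def subgroupProj (hp : IsQuotientCoveringMap p G) (H : Subgroup G) :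
    Quotient (MulAction.orbitRel H E) → X :=
  Quotient.lift p fun a b hab => by
    obtain ⟨g, _, rfl⟩ := mk_eq_mk_iff.1 (Quotient.sound hab)
    exact hp.map_smul g

theorem subgroupProj_mk (hp : IsQuotientCoveringMap p G) (H : Subgroup G) (e : E) :
    hp.subgroupProj H (Quotient.mk _ e) = p e := rfl

theorem eq_of_smul_eq (hp : IsQuotientCoveringMap p G) {g k : G} {e : E}
    (h : g • e = k • e) : g = k :=
  have := hp.isCancelSMul
  IsCancelSMul.right_cancel _ _ e h

theorem exists_smul_eq (hp : IsQuotientCoveringMap p G) {a b : E} (h : p a = p b) :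
    ∃ g : G, g • b = a :=
  MulAction.mem_orbit_iff.1 (hp.apply_eq_iff_mem_orbit.1 h)

/-- If the translates of `U` under `G` are disjoint, the sheets over `p '' U` are indexed by right
cosets `H g`: the translates of `U` by elements of one such coset have the same image in the orbit
space of `H`, and different cosets give disjoint images. -/
theorem isCoveringMap_subgroupProj (hp : IsQuotientCoveringMap p G) (H : Subgroup G) :
    IsCoveringMap (hp.subgroupProj H) := by
  have hq := hp.mk_subgroup H
  have := hp.toContinuousConstSMul
  have hqo : IsOpenMap (Quotient.mk (MulAction.orbitRel H E)) := hq.isOpenQuotientMap.isOpenMap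
  have hpo : IsOpenMap p := hp.isOpenQuotientMap.isOpenMap
  have hr : Continuous (hp.subgroupProj H) := hp.continuous.quotient_lift _
  have hro : IsOpenMap (hp.subgroupProj H) := by
    intro O hO
    have : hp.subgroupProj H '' O = p '' (Quotient.mk (MulAction.orbitRel H E) ⁻¹' O) := by
      ext x
      constructor
      · rintro ⟨y, hy, rfl⟩
        obtain ⟨e, rfl⟩ := Quotient.exists_rep y
        exact ⟨e, hy, rfl⟩
      · rintro ⟨e, he, rfl⟩
        exact ⟨_, he, rfl⟩
    rw [this]
    exact hpo _ (hO.preimage hq.continuous)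
  let ι := Quotient (QuotientGroup.rightRel H)
  let : TopologicalSpace ι := ⊥
  have : DiscreteTopology ι := ⟨rfl⟩
  have : Nonempty ι := ⟨Quotient.mk _ 1⟩
  suffices h : ∀ x : X, ∃ t : Bundle.Trivialization ι (hp.subgroupProj H), x ∈ t.baseSet by
    choose t ht using h
    exact IsCoveringMap.mk _ (fun _ => ι) t ht
  intro x
  obtain ⟨e, rfl⟩ := hp.surjective x
  obtain ⟨U₀, hU₀, hd₀⟩ := hp.disjoint e
  obtain ⟨U, hUU, hU, heU⟩ := mem_nhds_iff.1 hU₀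
  have hd : ∀ (g k : G) (a b : E), a ∈ U → b ∈ U → g • a = k • b → g = k := by
    intro g k a b ha hb h
    have h1 : (k⁻¹ * g) • a = b := by rw [mul_smul, h, inv_smul_smul]
    have h2 := hd₀ (k⁻¹ * g) ⟨b, ⟨a, hUU ha, h1⟩, hUU hb⟩
    exact (inv_mul_eq_one.1 h2).symm
  have : Nonempty (X → Quotient (MulAction.orbitRel H E)) := ⟨fun _ => Quotient.mk _ e⟩
  let S : ι → Set (Quotient (MulAction.orbitRel H E)) :=
    fun c => Quotient.mk (MulAction.orbitRel H E) '' ((c.out • ·) '' U)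
  have hS : ∀ c, IsOpen (S c) := fun c => hqo _ (isOpenMap_smul c.out _ hU)
  have hsurj : ∀ c, (S c).SurjOn (hp.subgroupProj H) (p '' U) := by
    rintro c _ ⟨a, ha, rfl⟩
    exact ⟨_, ⟨_, ⟨a, ha, rfl⟩, rfl⟩, hp.map_smul _⟩
  refine ⟨IsOpen.trivializationDiscrete S (p '' U) (hpo _ hU) ?_ ?_ hsurj ?_ ?_, e, heU, rfl⟩
  · intro c W hW
    refine ⟨fun h => (h.preimage hr).inter (hS c), fun h => ?_⟩
    have : W = hp.subgroupProj H '' (hp.subgroupProj H ⁻¹' W ∩ S c) := by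
      ext y
      constructor
      · intro hy
        obtain ⟨z, hz, rfl⟩ := hsurj c (hW hy)
        exact ⟨z, ⟨hy, hz⟩, rfl⟩
      · rintro ⟨z, ⟨hz, -⟩, rfl⟩
        exact hz
    rw [this]
    exact hro _ h
  · rintro c _ ⟨_, ⟨a, ha, rfl⟩, rfl⟩ _ ⟨_, ⟨b, hb, rfl⟩, rfl⟩ h
    rw [subgroupProj_mk, subgroupProj_mk, hp.map_smul, hp.map_smul] at h
    obtain ⟨g, hg⟩ := hp.exists_smul_eq h
    have : g = 1 := hd g 1 b a hb ha (by rw [hg, one_smul])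
    rw [this, one_smul] at hg
    rw [hg]
  · intro c c' hcc
    rw [Function.onFun, Set.disjoint_left]
    rintro _ ⟨_, ⟨a, ha, rfl⟩, rfl⟩ ⟨_, ⟨b, hb, rfl⟩, hab⟩
    obtain ⟨h, hh, hx⟩ := mk_eq_mk_iff.1 hab
    dsimp only at hx
    rw [smul_smul] at hx
    have := hd _ _ a b ha hb hx
    apply hcc
    rw [← Quotient.out_eq c, ← Quotient.out_eq c', Quotient.eq, QuotientGroup.rightRel_apply,
      ← this]
    simpa using hh
  · intro y hy
    obtain ⟨b, rfl⟩ := Quotient.exists_rep y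
    obtain ⟨a, ha, hab⟩ := hy
    obtain ⟨k, rfl⟩ := hp.exists_smul_eq hab.symm
    refine Set.mem_iUnion.2 ⟨Quotient.mk _ k, ?_⟩
    have hk : QuotientGroup.rightRel H (Quotient.mk (QuotientGroup.rightRel H) k).out k :=
      Quotient.mk_out k
    rw [QuotientGroup.rightRel_apply] at hk
    refine ⟨_, ⟨a, ha, rfl⟩, mk_eq_mk_iff.2 ⟨_, inv_mem hk, ?_⟩⟩
    rw [smul_smul]
    congr 1
    group

/-- The fibre over `p e` consists of the `H`-orbits in `G • e`. The inverse in `g ↦ [g⁻¹ • e]`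
matches these orbits with left cosets, which are what `Subgroup.index` counts. -/
theorem card_fiber_subgroupProj (hp : IsQuotientCoveringMap p G) (H : Subgroup G) (x : X) :
    Nat.card (hp.subgroupProj H ⁻¹' {x}) = H.index := by
  obtain ⟨e, rfl⟩ := hp.surjective x
  refine (Nat.card_congr (Equiv.ofBijective
    (Quotient.lift (fun g : G => (⟨Quotient.mk _ (g⁻¹ • e), hp.map_smul _⟩ :
      hp.subgroupProj H ⁻¹' {p e})) ?_) ⟨?_, ?_⟩)).symm
  · intro a b hab
    have h : a⁻¹ * b ∈ H := QuotientGroup.leftRel_apply.1 hab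
    refine Subtype.ext (mk_eq_mk_iff.2 ⟨_, h, ?_⟩)
    rw [smul_smul, mul_inv_cancel_right]
  · intro a b
    refine Quotient.inductionOn₂ a b fun a b hab => Quotient.sound ?_
    obtain ⟨h, hh, hx⟩ := mk_eq_mk_iff.1 (Subtype.ext_iff.1 hab)
    rw [smul_smul] at hx
    have := hp.eq_of_smul_eq hx
    refine QuotientGroup.leftRel_apply.2 ?_
    rwa [← this, inv_mul_cancel_right]
  · rintro ⟨y, hy⟩
    obtain ⟨b, rfl⟩ := Quotient.exists_rep y
    obtain ⟨k, rfl⟩ := hp.exists_smul_eq (show p b = p e from hy)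
    exact ⟨Quotient.mk _ k⁻¹, Subtype.ext (by simp)⟩

variable [SimplyConnectedSpace E] [LocallyPathConnectedSpace E]

/-- As `E` is simply connected, `p` lifts to `f : E → N`; the subgroup is the group of those `g`
with `f ∘ g = f`. By uniqueness of lifts, the fibres of `f` are exactly its orbits. -/
theorem exists_subgroup_homeomorph (hp : IsQuotientCoveringMap p G) {N : Type*}
    [TopologicalSpace N] [ConnectedSpace N] {r : N → X} (hr : IsCoveringMap r) :
    ∃ H : Subgroup G, ∃ h : Quotient (MulAction.orbitRel H E) ≃ₜ N,
      hp.subgroupProj H = r ∘ h := by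
  have := hp.toContinuousConstSMul
  let P : C(E, X) := ⟨p, hp.continuous⟩
  obtain ⟨y₀⟩ := (inferInstance : Nonempty N)
  obtain ⟨e₀, he₀⟩ := hp.surjective (r y₀)
  obtain ⟨f, ⟨hf0, hfr⟩, -⟩ := hr.existsUnique_continuousMap_lifts P e₀ y₀ he₀.symm
  have hfr' : ∀ e, r (f e) = p e := fun e => congrFun hfr e
  have hopen : ∀ k : C(E, N), r ∘ k = P → IsOpenMap k := by
    intro k hk
    refine (IsLocalHomeomorph.of_comp (g := r) ?_ hr.isLocalHomeomorph k.continuous).isOpenMap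
    rw [hk]
    exact hp.isCoveringMap.isLocalHomeomorph
  have hshift : ∀ (k : C(E, N)) (g : G) (a : E), r ∘ k = P → k a = f (g • a) →
      ∀ x, k x = f (g • x) := by
    intro k g a hk h
    have hc : Continuous fun x : E => f (g • x) := f.continuous.comp (continuous_const_smul g)
    refine congrFun (hr.eq_of_comp_eq k.continuous hc ?_ a h)
    rw [hk]
    funext x
    simp [P, hfr', hp.map_smul]
  have hsurj : Function.Surjective f := by
    rw [← Set.range_eq_univ]
    -- For `y` outside the range, the lift `k` of `p` through `y` has open range. If that met the
    -- range of `f`, then `k` would be `f ∘ g` for some `g`, and `y` would be a value of `f`.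
    have hcl : IsClopen (Set.range f) := by
      refine ⟨⟨?_⟩, (hopen f hfr).isOpen_range⟩
      rw [isOpen_iff_mem_nhds]
      intro y hy
      obtain ⟨e, he⟩ := hp.surjective (r y)
      obtain ⟨k, ⟨hk0, hkr⟩, -⟩ := hr.existsUnique_continuousMap_lifts P e y he.symm
      refine Filter.mem_of_superset ((hopen k hkr).isOpen_range.mem_nhds ⟨e, hk0⟩) ?_
      rintro _ ⟨a, rfl⟩ ⟨b, hb⟩
      have hab : p b = p a := by
        rw [← hfr' b, hb]
        exact congrFun hkr a
      obtain ⟨g, rfl⟩ := hp.exists_smul_eq hab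
      exact hy ⟨g • e, by rw [← hshift k g a hkr hb.symm, hk0]⟩
    exact (isClopen_iff.1 hcl).resolve_left (Set.range_nonempty f).ne_empty
  let H : Subgroup G :=
    { carrier := {g | ∀ x, f (g • x) = f x}
      one_mem' := fun x => by rw [one_smul]
      mul_mem' := fun {a b} ha hb x => by rw [mul_smul, ha, hb]
      inv_mem' := fun {a} ha x => by rw [← ha (a⁻¹ • x), smul_inv_smul] }
  have hf : IsQuotientMap f := (hopen f hfr).isQuotientMap f.continuous hsurj
  obtain ⟨h, hh⟩ := exists_homeomorph_of_isQuotientMap (hp.mk_subgroup H).toIsQuotientMap hf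
    (fun a b => by
      rw [mk_eq_mk_iff]
      constructor
      · rintro ⟨g, hg, rfl⟩
        exact hg b
      · intro hab
        obtain ⟨g, rfl⟩ := hp.exists_smul_eq (show p a = p b by rw [← hfr', ← hfr', hab])
        exact ⟨g, fun x => (hshift f g b hfr hab.symm x).symm, rfl⟩)
  refine ⟨H, h, ?_⟩
  funext y
  obtain ⟨e, rfl⟩ := Quotient.exists_rep y
  rw [Function.comp_apply, hh, hfr', subgroupProj_mk]

-- An equivalence sends `[e₀]` to some `[g • e₀]`. Uniqueness of lifts then forces it to be `[x] ↦
-- [g • x]` everywhere, and this is well defined and injective exactly when `H' = g H g⁻¹`.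
omit [SimplyConnectedSpace E] [LocallyPathConnectedSpace E] in
theorem exists_homeomorph_subgroupProj_iff [ConnectedSpace E] (hp : IsQuotientCoveringMap p G)
    (H H' : Subgroup G) :
    (∃ h : Quotient (MulAction.orbitRel H E) ≃ₜ Quotient (MulAction.orbitRel H' E),
      hp.subgroupProj H = hp.subgroupProj H' ∘ h) ↔ H' ∈ subgroupConjClass H := by
  have := hp.toContinuousConstSMul
  constructor
  · rintro ⟨h, hh⟩
    obtain ⟨e₀⟩ := (inferInstance : Nonempty E)
    obtain ⟨e₁, he₁⟩ := Quotient.exists_rep (h (Quotient.mk _ e₀))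
    have hpe : p e₁ = p e₀ := by
      rw [← hp.subgroupProj_mk H' e₁, he₁, ← hp.subgroupProj_mk H e₀, hh, Function.comp_apply]
    obtain ⟨g, rfl⟩ := hp.exists_smul_eq hpe
    have key : ∀ x : E, Quotient.mk (MulAction.orbitRel H' E) (g • x) = h (Quotient.mk _ x) := by
      refine congrFun ((hp.isCoveringMap_subgroupProj H').eq_of_comp_eq
        ((hp.mk_subgroup H').continuous.comp (continuous_const_smul g))
        (h.continuous.comp (hp.mk_subgroup H).continuous) ?_ e₀ he₁)
      funext x
      have := congrFun hh (Quotient.mk _ x)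
      rw [Function.comp_apply, subgroupProj_mk] at this
      simp only [Function.comp_apply]
      rw [← this, subgroupProj_mk, hp.map_smul]
    refine ⟨g, ?_⟩
    have hmem : ∀ k : G, k ∈ H ↔ g * k * g⁻¹ ∈ H' := by
      intro k
      have h1 : k ∈ H ↔ Quotient.mk (MulAction.orbitRel H E) (k • e₀) = Quotient.mk _ e₀ := by
        rw [mk_eq_mk_iff]
        exact ⟨fun hk => ⟨k, hk, rfl⟩, fun ⟨l, hl, hx⟩ => hp.eq_of_smul_eq hx ▸ hl⟩
      rw [h1, ← h.injective.eq_iff, ← key, ← key, mk_eq_mk_iff]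
      constructor
      · rintro ⟨l, hl, hx⟩
        rw [smul_smul, smul_smul] at hx
        rwa [← hp.eq_of_smul_eq hx, mul_inv_cancel_right]
      · intro hk
        exact ⟨_, hk, by simp [smul_smul]⟩
    ext k
    rw [Subgroup.mem_map]
    constructor
    · intro hk
      refine ⟨g⁻¹ * k * g, ?_, by simp [mul_assoc]⟩
      rw [hmem]
      simpa [mul_assoc] using hk
    · rintro ⟨l, hl, rfl⟩
      exact (hmem l).1 hl
  · rintro ⟨g, rfl⟩
    obtain ⟨h, hh⟩ := exists_homeomorph_of_isQuotientMap (hp.mk_subgroup H).toIsQuotientMap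
      (g := fun x => Quotient.mk (MulAction.orbitRel (H.map (MulAut.conj g).toMonoidHom) E) (g • x))
      ((hp.mk_subgroup _).toIsQuotientMap.comp (Homeomorph.smul g).isQuotientMap)
      (fun a b => by
        rw [mk_eq_mk_iff, mk_eq_mk_iff]
        constructor
        · rintro ⟨k, hk, rfl⟩
          exact ⟨_, Subgroup.mem_map_of_mem _ hk, by simp [smul_smul]⟩
        · rintro ⟨_, ⟨k, hk, rfl⟩, hx⟩
          refine ⟨k, hk, ?_⟩
          simp only [MulEquiv.coe_toMonoidHom, MulAut.conj_apply, smul_smul,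
            inv_mul_cancel_right] at hx
          rw [mul_smul] at hx
          exact smul_left_cancel g hx)
    refine ⟨h, ?_⟩
    funext y
    obtain ⟨e, rfl⟩ := Quotient.exists_rep y
    rw [Function.comp_apply, hh, subgroupProj_mk, subgroupProj_mk, hp.map_smul]

end IsQuotientCoveringMap

theorem mem_subgroupConjClass_self {G : Type*} [Group G] (S : Subgroup G) :
    S ∈ subgroupConjClass S := by
  refine ⟨1, ?_⟩
  ext k
  simp [Subgroup.mem_map]

theorem subgroupConjClass_eq_iff {G : Type*} [Group G] {S T : Subgroup G} :
    subgroupConjClass S = subgroupConjClass T ↔ T ∈ subgroupConjClass S := by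
  constructor
  · intro h
    rw [h]
    exact mem_subgroupConjClass_self T
  · rintro ⟨g, rfl⟩
    have hc : ∀ (a b : G) (U : Subgroup G), (U.map (MulAut.conj b).toMonoidHom).map
        (MulAut.conj a).toMonoidHom = U.map (MulAut.conj (a * b)).toMonoidHom := by
      intro a b U
      rw [Subgroup.map_map]
      congr 1
      ext x
      simp
    ext U
    constructor
    · rintro ⟨k, rfl⟩
      exact ⟨k * g⁻¹, by rw [hc, inv_mul_cancel_right]⟩
    · rintro ⟨k, rfl⟩
      exact ⟨k * g, by rw [hc]⟩

/-- Equivalence classes of connected `n`-fold coverings of `X = E / G` correspond to conjugacy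
classes of subgroups of index `n` in `G`. -/
theorem IsQuotientCoveringMap.nonempty_coveringClasses_equiv {E : Type} {X : Type v}
    [TopologicalSpace E] [TopologicalSpace X] {p : E → X} {G : Type*} [Group G] [MulAction G E]
    [SimplyConnectedSpace E] [LocallyPathConnectedSpace E] (hp : IsQuotientCoveringMap p G)
    (n : ℕ) (M : Type w) [TopologicalSpace M] :
    Nonempty (CoveringClasses.{u} X n M ≃ {O : Set (Subgroup G) | ∃ S : Subgroup G, S.index = n ∧
      Nonempty (Quotient (MulAction.orbitRel S E) ≃ₜ M) ∧ O = subgroupConjClass S}) := by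
  have hex : ∀ c : {c : NFoldCovering.{u} X n // Nonempty (c.Total ≃ₜ M)},
      ∃ S : Subgroup G, ∃ h : Quotient (MulAction.orbitRel S E) ≃ₜ c.1.Total,
        hp.subgroupProj S = c.1.proj ∘ h :=
    fun c => hp.exists_subgroup_homeomorph c.1.isCoveringMap
  choose S h hS using hex
  have hind : ∀ c, (S c).index = n := by
    intro c
    obtain ⟨e⟩ := (inferInstance : Nonempty E)
    let x := p e
    rw [← hp.card_fiber_subgroupProj (S c) x, ← c.1.card_fiber x]
    refine Nat.card_congr ((h c).toEquiv.subtypeEquiv fun y => ?_)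
    rw [hS]
    rfl
  have hrel : ∀ c d, c.1.Equivalent d.1 ↔ subgroupConjClass (S c) = subgroupConjClass (S d) := by
    intro c d
    rw [subgroupConjClass_eq_iff, ← hp.exists_homeomorph_subgroupProj_iff]
    constructor
    · rintro ⟨k, hk⟩
      refine ⟨((h c).trans k).trans (h d).symm, ?_⟩
      funext y
      simp [hS, hk]
    · rintro ⟨k, hk⟩
      refine ⟨((h c).symm.trans k).trans (h d), ?_⟩
      funext y
      have := congrFun hk ((h c).symm y)
      rw [hS, hS] at this
      simpa using this
  refine ⟨Equiv.ofBijective (Quotient.lift (fun c => ⟨subgroupConjClass (S c), S c, hind c,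
    ⟨(h c).trans c.2.some⟩, rfl⟩) fun c d hcd => Subtype.ext ((hrel c d).1 hcd)) ⟨?_, ?_⟩⟩
  · intro a b
    refine Quotient.inductionOn₂ a b fun c d hcd => Quotient.sound ((hrel c d).2 ?_)
    exact Subtype.ext_iff.1 hcd
  · rintro ⟨_, T, hT, ⟨k⟩, rfl⟩
    -- The orbit space lies in `Type`; `ULift` moves it to the universe of the coverings being
    -- classified.
    have : ConnectedSpace (ULift.{u} (Quotient (MulAction.orbitRel T E))) :=
      Homeomorph.ulift.symm.surjective.connectedSpace Homeomorph.ulift.symm.continuous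
    let c : NFoldCovering.{u} X n :=
      { Total := ULift.{u} (Quotient (MulAction.orbitRel T E))
        proj := hp.subgroupProj T ∘ Homeomorph.ulift
        isCoveringMap := (hp.isCoveringMap_subgroupProj T).comp_homeomorph Homeomorph.ulift
        card_fiber := fun x => by
          rw [← hT, ← hp.card_fiber_subgroupProj T x]
          exact Nat.card_congr (Homeomorph.ulift.toEquiv.subtypeEquiv fun y => Iff.rfl) }
    refine ⟨Quotient.mk _ ⟨c, ⟨Homeomorph.ulift.trans k⟩⟩, Subtype.ext ?_⟩
    refine subgroupConjClass_eq_iff.2 ?_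
    rw [← hp.exists_homeomorph_subgroupProj_iff]
    refine ⟨(h ⟨c, ⟨Homeomorph.ulift.trans k⟩⟩).trans Homeomorph.ulift, ?_⟩
    rw [hS]
    rfl

/-! ### Subgroups of a semidirect product `A ⋊ ℤ`. -/

/-- The semidirect product `A ⋊ ℤ` in which the generator of `ℤ` acts on `A` by `φ`. -/
@[ext]
structure TwistedProduct {A : Type*} [AddCommGroup A] (φ : A ≃ₗ[ℤ] A) where
  /-- The component in the normal subgroup `A`. -/
  base : A
  /-- The component in `ℤ`. -/
  deg : ℤ

theorem LinearEquiv.zpow_add_apply {A : Type*} [AddCommGroup A] (φ : A ≃ₗ[ℤ] A) (m n : ℤ) (a : A) :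
    (φ ^ (m + n)) a = (φ ^ m) ((φ ^ n) a) := by
  rw [zpow_add]
  rfl

theorem LinearEquiv.zpow_mul_mem_iff {A : Type*} [AddCommGroup A] {φ : A ≃ₗ[ℤ] A} {d : ℤ}
    {L : AddSubgroup A} (hL : ∀ a, (φ ^ d) a ∈ L ↔ a ∈ L) (j : ℤ) (a : A) :
    (φ ^ (d * j)) a ∈ L ↔ a ∈ L := by
  induction j with
  | zero => simp
  | succ i ih => rw [mul_add, mul_one, add_comm, LinearEquiv.zpow_add_apply, hL, ih]
  | pred i ih =>
    rw [← hL, ← LinearEquiv.zpow_add_apply, ← ih]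
    congr! 3
    ring

theorem Int.addSubgroup_eq_zmultiples_index (H : AddSubgroup ℤ) :
    H = AddSubgroup.zmultiples (H.index : ℤ) := by
  obtain ⟨a, rfl⟩ : ∃ a, H = AddSubgroup.zmultiples a :=
    ⟨_, (Int.subgroup_cyclic H).choose_spec.trans (AddSubgroup.zmultiples_eq_closure _).symm⟩
  rw [Int.index_zmultiples, Int.zmultiples_natAbs]

namespace TwistedProduct

variable {A : Type*} [AddCommGroup A] {φ : A ≃ₗ[ℤ] A}

instance : Mul (TwistedProduct φ) := ⟨fun x y => ⟨x.base + (φ ^ x.deg) y.base, x.deg + y.deg⟩⟩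

instance : One (TwistedProduct φ) := ⟨⟨0, 0⟩⟩

instance : Inv (TwistedProduct φ) := ⟨fun x => ⟨-(φ ^ (-x.deg)) x.base, -x.deg⟩⟩

@[simp] theorem mul_base (x y : TwistedProduct φ) :
    (x * y).base = x.base + (φ ^ x.deg) y.base := rfl
@[simp] theorem mul_deg (x y : TwistedProduct φ) : (x * y).deg = x.deg + y.deg := rfl
@[simp] theorem one_base : (1 : TwistedProduct φ).base = 0 := rfl
@[simp] theorem one_deg : (1 : TwistedProduct φ).deg = 0 := rfl
@[simp] theorem inv_base (x : TwistedProduct φ) : (x⁻¹).base = -(φ ^ (-x.deg)) x.base := rfl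
@[simp] theorem inv_deg (x : TwistedProduct φ) : (x⁻¹).deg = -x.deg := rfl

instance : Group (TwistedProduct φ) :=
  Group.ofLeftAxioms
    (fun x y z => by
      ext
      · simp [LinearEquiv.zpow_add_apply, add_assoc]
      · simp [add_assoc])
    (fun x => by ext <;> simp)
    (fun x => by ext <;> simp)

@[simp] theorem zpow_deg (x : TwistedProduct φ) (j : ℤ) : (x ^ j).deg = x.deg * j := by
  let f : TwistedProduct φ →* Multiplicative ℤ :=
    { toFun := fun x => Multiplicative.ofAdd x.deg
      map_one' := rfl
      map_mul' := fun _ _ => rfl }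
  have := congrArg Multiplicative.toAdd (map_zpow f x j)
  rw [toAdd_zpow] at this
  simpa [f, mul_comm] using this

/-- Besides acting by `φ ^ g.deg`, conjugation adds the coboundary `g.base - (φ ^ x.deg) g.base`. It
vanishes when `φ ^ x.deg = 1`, and otherwise decides which cosets become conjugate. -/
theorem conj_eq (g x : TwistedProduct φ) :
    g * x * g⁻¹ = ⟨g.base + (φ ^ g.deg) x.base - (φ ^ x.deg) g.base, x.deg⟩ := by
  ext
  · simp only [mul_base, inv_base, mul_deg, map_neg, ← LinearEquiv.zpow_add_apply, sub_eq_add_neg]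
    congr! 4
    ring
  · simp

/-- The intersection of a subgroup with the factor `A`. -/
def fib (S : Subgroup (TwistedProduct φ)) : AddSubgroup A where
  carrier := {a | (⟨a, 0⟩ : TwistedProduct φ) ∈ S}
  zero_mem' := S.one_mem
  add_mem' {a b} ha hb := by
    have := S.mul_mem ha hb
    rwa [show (⟨a, 0⟩ : TwistedProduct φ) * ⟨b, 0⟩ = ⟨a + b, 0⟩ by ext <;> simp] at this
  neg_mem' {a} ha := by
    have := S.inv_mem ha
    rwa [show (⟨a, 0⟩ : TwistedProduct φ)⁻¹ = ⟨-a, 0⟩ by ext <;> simp] at this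

theorem mem_fib {S : Subgroup (TwistedProduct φ)} {a : A} :
    a ∈ fib S ↔ (⟨a, 0⟩ : TwistedProduct φ) ∈ S := Iff.rfl

/-- The image of a subgroup in the factor `ℤ`. -/
def degs (S : Subgroup (TwistedProduct φ)) : AddSubgroup ℤ where
  carrier := {k | ∃ x ∈ S, x.deg = k}
  zero_mem' := ⟨1, S.one_mem, rfl⟩
  add_mem' := by
    rintro _ _ ⟨x, hx, rfl⟩ ⟨y, hy, rfl⟩
    exact ⟨_, S.mul_mem hx hy, rfl⟩
  neg_mem' := by
    rintro _ ⟨x, hx, rfl⟩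
    exact ⟨_, S.inv_mem hx, rfl⟩

theorem mem_degs {S : Subgroup (TwistedProduct φ)} {k : ℤ} :
    k ∈ degs S ↔ ∃ x ∈ S, x.deg = k := Iff.rfl

/-- The nonnegative generator of the image of a subgroup in `ℤ`. -/
noncomputable def degree (S : Subgroup (TwistedProduct φ)) : ℕ := (degs S).index

theorem exists_mem_iff_degree_dvd {S : Subgroup (TwistedProduct φ)} {k : ℤ} :
    (∃ u, (⟨u, k⟩ : TwistedProduct φ) ∈ S) ↔ (degree S : ℤ) ∣ k := by
  have h : k ∈ degs S ↔ (degree S : ℤ) ∣ k := by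
    rw [Int.addSubgroup_eq_zmultiples_index (degs S), Int.mem_zmultiples_iff]
    rfl
  rw [← h, mem_degs]
  constructor
  · rintro ⟨u, hu⟩
    exact ⟨_, hu, rfl⟩
  · rintro ⟨x, hx, rfl⟩
    exact ⟨x.base, hx⟩

theorem degree_dvd_of_mem {S : Subgroup (TwistedProduct φ)} {x : TwistedProduct φ}
    (hx : x ∈ S) : (degree S : ℤ) ∣ x.deg :=
  exists_mem_iff_degree_dvd.1 ⟨x.base, hx⟩

theorem exists_mem_degree (S : Subgroup (TwistedProduct φ)) :
    ∃ u, (⟨u, degree S⟩ : TwistedProduct φ) ∈ S :=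
  exists_mem_iff_degree_dvd.2 dvd_rfl

theorem degree_eq_of_forall {S : Subgroup (TwistedProduct φ)} {d : ℕ}
    (h : ∀ k : ℤ, (∃ u, (⟨u, k⟩ : TwistedProduct φ) ∈ S) ↔ (d : ℤ) ∣ k) : degree S = d := by
  have h1 := exists_mem_iff_degree_dvd (S := S) (k := d)
  have h2 := exists_mem_iff_degree_dvd (S := S) (k := degree S)
  rw [h] at h1 h2
  exact Nat.dvd_antisymm (Int.natCast_dvd_natCast.1 (h1.1 dvd_rfl))
    (Int.natCast_dvd_natCast.1 (h2.2 dvd_rfl))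

/-- The products `(0, i) * (a, 0)`, with `i` and `a` running through representatives modulo `degs S`
and `fib S`, meet every left coset once. With `(0, i)` on the left, two such products of equal
degree are compared inside `A`. -/
theorem index_eq_degree_mul (S : Subgroup (TwistedProduct φ)) :
    S.index = degree S * (fib S).index := by
  have hb : Function.Bijective (fun q : (ℤ ⧸ degs S) × (A ⧸ fib S) =>
      (QuotientGroup.mk ((⟨0, q.1.out⟩ : TwistedProduct φ) * ⟨q.2.out, 0⟩) :
        TwistedProduct φ ⧸ S)) := by
    constructor
    · rintro ⟨i, a⟩ ⟨j, b⟩ h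
      rw [QuotientGroup.eq] at h
      have hij : i = j := by
        rw [← QuotientAddGroup.out_eq' i, ← QuotientAddGroup.out_eq' j, QuotientAddGroup.eq]
        exact ⟨_, h, by simp⟩
      subst hij
      have hab : a = b := by
        rw [← QuotientAddGroup.out_eq' a, ← QuotientAddGroup.out_eq' b, QuotientAddGroup.eq,
          mem_fib]
        convert h using 1
        ext <;> simp
      rw [hab]
    · intro q
      obtain ⟨x, rfl⟩ := QuotientGroup.mk_surjective q
      let i : ℤ ⧸ degs S := QuotientAddGroup.mk x.deg
      have hi : -i.out + x.deg ∈ degs S := by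
        rw [← QuotientAddGroup.eq, QuotientAddGroup.out_eq']
      obtain ⟨y, hy, hyd⟩ := hi
      let a : A := (φ ^ (-i.out)) (x * y⁻¹).base
      let c : A ⧸ fib S := QuotientAddGroup.mk a
      have hc : -c.out + a ∈ fib S := by
        rw [← QuotientAddGroup.eq, QuotientAddGroup.out_eq']
      refine ⟨(i, c), ?_⟩
      dsimp only
      rw [QuotientGroup.eq]
      have h2 := S.mul_mem hc hy
      convert h2 using 1
      have hxy : x = (⟨0, i.out⟩ : TwistedProduct φ) * ⟨a, 0⟩ * y := by
        rw [← mul_inv_eq_iff_eq_mul]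
        ext
        · simp [a]
        · simp [hyd]
      rw [inv_mul_eq_iff_eq_mul, hxy]
      have : (⟨a, 0⟩ : TwistedProduct φ) = ⟨c.out, 0⟩ * ⟨-c.out + a, 0⟩ := by
        ext <;> simp
      rw [this]
      simp only [mul_assoc]
  rw [Subgroup.index, ← Nat.card_congr (Equiv.ofBijective _ hb), Nat.card_prod]
  rfl

/-- Conjugation by `x ∈ S` preserves `S` and acts on `A` as `φ ^ x.deg`. -/
theorem zpow_degree_mem_fib_iff {S : Subgroup (TwistedProduct φ)} {x : TwistedProduct φ}
    (hx : x ∈ S) (a : A) : (φ ^ x.deg) a ∈ fib S ↔ a ∈ fib S := by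
  have h : x * ⟨a, 0⟩ * x⁻¹ = ⟨(φ ^ x.deg) a, 0⟩ := by
    rw [conj_eq]
    simp
  rw [mem_fib, mem_fib, ← h]
  constructor
  · intro h
    simpa [mul_assoc] using S.mul_mem (S.mul_mem (S.inv_mem hx) h) hx
  · intro h
    exact S.mul_mem (S.mul_mem hx h) (S.inv_mem hx)

theorem zpow_natDegree_mem_fib_iff (S : Subgroup (TwistedProduct φ)) (a : A) :
    (φ ^ (degree S : ℤ)) a ∈ fib S ↔ a ∈ fib S := by
  obtain ⟨u, hu⟩ := exists_mem_degree S
  exact zpow_degree_mem_fib_iff hu a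

theorem sub_mem_fib {S : Subgroup (TwistedProduct φ)} {k : ℤ} {a b : A}
    (ha : (⟨a, k⟩ : TwistedProduct φ) ∈ S) :
    (⟨b, k⟩ : TwistedProduct φ) ∈ S ↔ b - a ∈ fib S := by
  have h : (⟨b - a, 0⟩ : TwistedProduct φ) * ⟨a, k⟩ = ⟨b, k⟩ := by
    ext <;> simp
  rw [mem_fib, ← h]
  exact Subgroup.mul_mem_cancel_right S ha

/-- Dividing an element of `S` by a power of `x` brings it to degree 0. Hence the degree, the
intersection with `A` and a single element of minimal degree determine a subgroup. -/
theorem le_of_generators {S T : Subgroup (TwistedProduct φ)} {x : TwistedProduct φ}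
    (hxS : x ∈ S) (hxT : x ∈ T) (hd : ∀ y ∈ S, x.deg ∣ y.deg) (hf : fib S ≤ fib T) : S ≤ T := by
  intro y hy
  obtain ⟨j, hj⟩ := hd y hy
  have h : y * (x ^ j)⁻¹ = ⟨(y * (x ^ j)⁻¹).base, 0⟩ := by
    ext
    · rfl
    · simp [hj]
  have h1 : y * (x ^ j)⁻¹ ∈ S := S.mul_mem hy (S.inv_mem (S.zpow_mem hxS j))
  rw [h] at h1
  have h2 : (⟨(y * (x ^ j)⁻¹).base, 0⟩ : TwistedProduct φ) ∈ T := hf h1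
  rw [← h] at h2
  simpa using T.mul_mem h2 (T.zpow_mem hxT j)

theorem eq_of_generators {S T : Subgroup (TwistedProduct φ)} (hd : degree S = degree T)
    (hf : fib S = fib T) {u : A} (hS : (⟨u, degree S⟩ : TwistedProduct φ) ∈ S)
    (hT : (⟨u, degree S⟩ : TwistedProduct φ) ∈ T) : S = T :=
  le_antisymm (le_of_generators hS hT (fun _ hy => degree_dvd_of_mem hy) hf.le)
    (le_of_generators hT hS (fun _ hy => by dsimp only; rw [hd]; exact degree_dvd_of_mem hy) hf.ge)

/-- The subgroup generated by `L ≤ A` and the element `(u, d)`. -/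
def ofData (d : ℤ) (L : AddSubgroup A) (hL : ∀ a, (φ ^ d) a ∈ L ↔ a ∈ L) (u : A) :
    Subgroup (TwistedProduct φ) where
  carrier := {x | ∃ j : ℤ, ∃ l ∈ L, x = ⟨l, 0⟩ * ⟨u, d⟩ ^ j}
  one_mem' := ⟨0, 0, L.zero_mem, by ext <;> simp⟩
  mul_mem' := by
    rintro _ _ ⟨i, l, hl, rfl⟩ ⟨j, m, hm, rfl⟩
    have h : (⟨u, d⟩ : TwistedProduct φ) ^ i * ⟨m, 0⟩ = ⟨(φ ^ (d * i)) m, 0⟩ * ⟨u, d⟩ ^ i := by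
      rw [← mul_inv_eq_iff_eq_mul, conj_eq]
      ext <;> simp
    refine ⟨i + j, _, L.add_mem hl ((LinearEquiv.zpow_mul_mem_iff hL i m).2 hm), ?_⟩
    rw [zpow_add, show (⟨l + (φ ^ (d * i)) m, 0⟩ : TwistedProduct φ) =
      ⟨l, 0⟩ * ⟨(φ ^ (d * i)) m, 0⟩ by ext <;> simp]
    rw [mul_assoc, mul_assoc, ← mul_assoc (_ ^ i), h, mul_assoc]
  inv_mem' := by
    rintro _ ⟨i, l, hl, rfl⟩
    refine ⟨-i, _, L.neg_mem ((LinearEquiv.zpow_mul_mem_iff hL (-i) l).2 hl), ?_⟩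
    have h : (⟨u, d⟩ : TwistedProduct φ) ^ (-i) * ⟨-l, 0⟩ =
        ⟨-(φ ^ (d * -i)) l, 0⟩ * ⟨u, d⟩ ^ (-i) := by
      rw [← mul_inv_eq_iff_eq_mul, conj_eq]
      ext <;> simp
    rw [← h, mul_inv_rev, zpow_neg]
    congr 1

section ofData

variable {d : ℕ} {L : AddSubgroup A} (hL : ∀ a, (φ ^ (d : ℤ)) a ∈ L ↔ a ∈ L) (u : A)

theorem mk_mem_ofData : (⟨u, d⟩ : TwistedProduct φ) ∈ ofData (d : ℤ) L hL u :=
  ⟨1, 0, L.zero_mem, by ext <;> simp⟩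

theorem degree_ofData : degree (ofData (d : ℤ) L hL u) = d := by
  refine degree_eq_of_forall fun k => ⟨?_, ?_⟩
  · rintro ⟨v, j, l, -, h⟩
    have := congrArg TwistedProduct.deg h
    simp only [mul_deg, zpow_deg, zero_add] at this
    exact ⟨j, this⟩
  · rintro ⟨j, rfl⟩
    refine ⟨((⟨u, d⟩ : TwistedProduct φ) ^ j).base, j, 0, L.zero_mem, ?_⟩
    ext <;> simp

/-- Positivity of `d` is essential: for `d = 0` the powers of `(u, 0)` would enlarge the
intersection with `A` to `L + ℤ u`. -/
theorem fib_ofData (hd : 0 < d) : fib (ofData (d : ℤ) L hL u) = L := by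
  ext a
  rw [mem_fib]
  constructor
  · rintro ⟨j, l, hl, h⟩
    have h1 := congrArg TwistedProduct.deg h
    simp only [mul_deg, zpow_deg, zero_add] at h1
    have hj : j = 0 := by
      rcases mul_eq_zero.1 h1.symm with h | h
      · omega
      · exact h
    subst hj
    have h2 := congrArg TwistedProduct.base h
    simp only [zpow_zero, mul_one] at h2
    rwa [h2]
  · intro ha
    exact ⟨0, a, ha, by simp⟩

theorem index_ofData (hd : 0 < d) : (ofData (d : ℤ) L hL u).index = d * L.index := by
  rw [index_eq_degree_mul, degree_ofData, fib_ofData hL u hd]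

theorem mk_mem_ofData_iff (hd : 0 < d) {v : A} :
    (⟨v, d⟩ : TwistedProduct φ) ∈ ofData (d : ℤ) L hL u ↔ v - u ∈ L := by
  rw [sub_mem_fib (mk_mem_ofData hL u), fib_ofData hL u hd]

theorem ofData_eq_iff (hd : 0 < d) {S : Subgroup (TwistedProduct φ)} (hSd : degree S = d) :
    ofData (d : ℤ) L hL u = S ↔ fib S = L ∧ (⟨u, d⟩ : TwistedProduct φ) ∈ S := by
  constructor
  · rintro rfl
    exact ⟨fib_ofData hL u hd, mk_mem_ofData hL u⟩
  · rintro ⟨rfl, hu⟩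
    refine eq_of_generators (u := u) ?_ ?_ ?_ ?_
    · rw [degree_ofData, hSd]
    · rw [fib_ofData hL u hd]
    · rw [degree_ofData]
      exact mk_mem_ofData hL u
    · rwa [degree_ofData]

end ofData

/-- Subgroups with given positive degree correspond to pairs of an invariant subgroup of `A`
and one of its cosets. -/
theorem nonempty_equiv_sigma {d m : ℕ} (hd : 0 < d) (P : Subgroup (TwistedProduct φ) → Prop)
    (Q : AddSubgroup A → Prop) (hQ : ∀ L, Q L → ∀ a, (φ ^ (d : ℤ)) a ∈ L ↔ a ∈ L)
    (hPQ : ∀ S, degree S = d → P S → Q (fib S)) :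
    Nonempty ({S : Subgroup (TwistedProduct φ) // (degree S = d ∧ (fib S).index = m) ∧ P S} ≃
      Σ L : {L : AddSubgroup A // L.index = m ∧ Q L},
        {c : A ⧸ L.1 // P (ofData (d : ℤ) L.1 (hQ L.1 L.2.2) c.out)}) := by
  refine ⟨(Equiv.ofBijective (fun q => ⟨ofData (d : ℤ) q.1.1 (hQ _ q.1.2.2) q.2.1.out,
    ⟨degree_ofData _ _, (congrArg _ (fib_ofData _ _ hd)).trans q.1.2.1⟩, q.2.2⟩)
    ⟨?_, ?_⟩).symm⟩
  · rintro ⟨⟨L, hLm, hL⟩, ⟨c, hc⟩⟩ ⟨⟨L', hLm', hL'⟩, ⟨c', hc'⟩⟩ h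
    have h := Subtype.ext_iff.1 h
    dsimp only at h
    have hLL : L' = L := by
      rw [← fib_ofData (hQ _ hL) c.out hd, h, fib_ofData (hQ _ hL') c'.out hd]
    subst hLL
    have hcc : c = c' := by
      have h1 := mk_mem_ofData (hQ _ hL) c.out
      rw [h, mk_mem_ofData_iff _ _ hd] at h1
      rw [← QuotientAddGroup.out_eq' c, ← QuotientAddGroup.out_eq' c', eq_comm,
        QuotientAddGroup.eq, neg_add_eq_sub]
      exact h1
    subst hcc
    rfl
  · rintro ⟨S, ⟨rfl, rfl⟩, hS⟩
    obtain ⟨u, hu⟩ := exists_mem_degree S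
    have hinv := zpow_natDegree_mem_fib_iff S
    have key : ofData (degree S : ℤ) (fib S) hinv
        (QuotientAddGroup.mk u : A ⧸ fib S).out = S := by
      refine (ofData_eq_iff hinv _ hd rfl).2 ⟨rfl, ?_⟩
      rw [sub_mem_fib hu, ← neg_add_eq_sub, ← QuotientAddGroup.eq, QuotientAddGroup.out_eq']
    refine ⟨⟨⟨fib S, rfl, hPQ S rfl hS⟩, ⟨QuotientAddGroup.mk u, ?_⟩⟩, Subtype.ext key⟩
    rw [key]
    exact hS

/-- Subgroups of finite index, sorted by their degree. -/
theorem finite_and_card_subgroups {n : ℕ} (hn : 0 < n) (Q : ℕ → Prop) [DecidablePred Q]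
    (P : Subgroup (TwistedProduct φ) → Prop) {c : ℕ → ℕ}
    (hfin : ∀ d ∈ n.divisors, Q d →
      Finite {S : Subgroup (TwistedProduct φ) // (degree S = d ∧ (fib S).index = n / d) ∧ P S})
    (hc : ∀ d ∈ n.divisors, Q d → Nat.card
      {S : Subgroup (TwistedProduct φ) // (degree S = d ∧ (fib S).index = n / d) ∧ P S} = c d) :
    Finite {S : Subgroup (TwistedProduct φ) // S.index = n ∧ Q (degree S) ∧ P S} ∧
      Nat.card {S : Subgroup (TwistedProduct φ) // S.index = n ∧ Q (degree S) ∧ P S} =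
        ∑ d ∈ n.divisors with Q d, c d := by
  let D := {d // d ∈ n.divisors.filter Q}
  have hD : ∀ d : D, d.1 ∈ n.divisors ∧ Q d.1 := fun d => Finset.mem_filter.1 d.2
  have : ∀ d : D, Finite {S : Subgroup (TwistedProduct φ) //
      (degree S = d.1 ∧ (fib S).index = n / d.1) ∧ P S} :=
    fun d => hfin d.1 (hD d).1 (hD d).2
  have hind : ∀ S : Subgroup (TwistedProduct φ), S.index = n →
      degree S ∈ n.divisors ∧ (fib S).index = n / degree S := by
    intro S hS
    rw [index_eq_degree_mul] at hS
    refine ⟨Nat.mem_divisors.2 ⟨⟨_, hS.symm⟩, hn.ne'⟩, ?_⟩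
    rw [← hS, Nat.mul_div_cancel_left]
    exact Nat.pos_of_ne_zero fun h => by simp [h] at hS; omega
  let e : (Σ d : D, {S : Subgroup (TwistedProduct φ) //
      (degree S = d.1 ∧ (fib S).index = n / d.1) ∧ P S}) ≃
      {S : Subgroup (TwistedProduct φ) // S.index = n ∧ Q (degree S) ∧ P S} :=
    { toFun := fun q => ⟨q.2.1, by
        rw [index_eq_degree_mul, q.2.2.1.1, q.2.2.1.2]
        exact Nat.mul_div_cancel' (Nat.dvd_of_mem_divisors (hD q.1).1), by
        rw [q.2.2.1.1]
        exact (hD q.1).2, q.2.2.2⟩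
      invFun := fun S => ⟨⟨degree S.1, Finset.mem_filter.2 ⟨(hind S.1 S.2.1).1, S.2.2.1⟩⟩,
        ⟨S.1, ⟨rfl, (hind S.1 S.2.1).2⟩, S.2.2.2⟩⟩
      left_inv := by
        rintro ⟨⟨d, hd⟩, ⟨S, ⟨hSd, h⟩, hP⟩⟩
        obtain rfl : degree S = d := hSd
        rfl
      right_inv := fun _ => rfl }
  refine ⟨Finite.of_equiv _ e, ?_⟩
  rw [← Nat.card_congr e, Nat.card_sigma]
  exact (Finset.sum_congr rfl fun d _ => hc d.1 (hD d).1 (hD d).2).trans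
    (Finset.sum_coe_sort (n.divisors.filter Q) c)

/-- The number of subgroups of given index and degree, where a power of `φ` acts trivially. -/
theorem finite_and_card_of_trivial {d m : ℕ} (hd : 0 < d) (hm : 0 < m)
    (hφ : ∀ a, (φ ^ (d : ℤ)) a = a) [Finite {L : AddSubgroup A // L.index = m}] :
    Finite {S : Subgroup (TwistedProduct φ) // (degree S = d ∧ (fib S).index = m) ∧ True} ∧
      Nat.card {S : Subgroup (TwistedProduct φ) // (degree S = d ∧ (fib S).index = m) ∧ True} =
        Nat.card {L : AddSubgroup A // L.index = m} * m := by
  obtain ⟨e⟩ := nonempty_equiv_sigma (φ := φ) (m := m) hd (fun _ => True) (fun _ => True)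
    (fun L _ a => by rw [hφ]) (fun _ _ _ => trivial)
  have e' : {L : AddSubgroup A // L.index = m ∧ True} ≃ {L : AddSubgroup A // L.index = m} :=
    Equiv.subtypeEquivRight fun L => Iff.of_eq (and_true _)
  have : Finite {L : AddSubgroup A // L.index = m ∧ True} := Finite.of_equiv _ e'.symm
  have : Fintype {L : AddSubgroup A // L.index = m ∧ True} := Fintype.ofFinite _
  -- The coset is unconstrained, so every `L` of index `m` contributes `m` subgroups.
  have hcard : ∀ L : {L : AddSubgroup A // L.index = m ∧ True},
      Nat.card {c : A ⧸ L.1 // True} = m := by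
    intro L
    rw [Nat.card_congr (Equiv.subtypeUnivEquiv fun _ => trivial)]
    exact L.2.1
  have : ∀ L : {L : AddSubgroup A // L.index = m ∧ True}, Finite {c : A ⧸ L.1 // True} := by
    intro L
    refine Nat.finite_of_card_ne_zero ?_
    rw [hcard]
    exact hm.ne'
  refine ⟨Finite.of_equiv _ e.symm, ?_⟩
  rw [Nat.card_congr e, Nat.card_sigma, Finset.sum_congr rfl fun L _ => hcard L,
    Finset.sum_const, smul_eq_mul, ← Nat.card_congr e', Nat.card_eq_fintype_card]
  rfl

section conj

variable {S : Subgroup (TwistedProduct φ)} (g : TwistedProduct φ)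

theorem mem_map_conj_iff {G : Type*} [Group G] {S : Subgroup G} {g x : G} :
    x ∈ S.map (MulAut.conj g).toMonoidHom ↔ g⁻¹ * x * g ∈ S := by
  rw [Subgroup.mem_map]
  constructor
  · rintro ⟨y, hy, rfl⟩
    simpa [mul_assoc] using hy
  · intro h
    exact ⟨_, h, by simp [mul_assoc]⟩

theorem mk_mem_map_conj {u : A} {k : ℤ} (hu : (⟨u, k⟩ : TwistedProduct φ) ∈ S) :
    (⟨g.base + (φ ^ g.deg) u - (φ ^ k) g.base, k⟩ : TwistedProduct φ) ∈
      S.map (MulAut.conj g).toMonoidHom := by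
  have := Subgroup.mem_map_of_mem (MulAut.conj g).toMonoidHom hu
  simpa only [MulEquiv.coe_toMonoidHom, MulAut.conj_apply, conj_eq] using this

theorem degree_map_conj : degree (S.map (MulAut.conj g).toMonoidHom) = degree S := by
  refine degree_eq_of_forall fun k => ?_
  rw [← exists_mem_iff_degree_dvd]
  constructor
  · rintro ⟨u, hu⟩
    rw [mem_map_conj_iff] at hu
    have h := conj_eq g⁻¹ (⟨u, k⟩ : TwistedProduct φ)
    rw [inv_inv] at h
    rw [h] at hu
    exact ⟨_, hu⟩
  · rintro ⟨u, hu⟩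
    exact ⟨_, mk_mem_map_conj g hu⟩

theorem zpow_mem_fib_map_conj {a : A} :
    (φ ^ g.deg) a ∈ fib (S.map (MulAut.conj g).toMonoidHom) ↔ a ∈ fib S := by
  have h : g * ⟨a, 0⟩ * g⁻¹ = ⟨(φ ^ g.deg) a, 0⟩ := by
    rw [conj_eq]
    simp
  rw [mem_fib, mem_fib, ← h, mem_map_conj_iff]
  simp [mul_assoc]

end conj

end TwistedProduct

/-! ### Ideals of the Eisenstein integers and the function `θ`. -/

/-- The ring of Eisenstein integers, in the basis `1, ω` with `ω = exp (π i / 3)`. -/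
abbrev EisensteinInt : Type := QuadraticAlgebra ℤ (-1) 1

namespace EisensteinInt

open QuadraticAlgebra

/-- The primitive cube root of unity `ω - 1 = ω²`. -/
def zeta : EisensteinInt := ⟨-1, 1⟩

theorem zeta_pow_three : zeta ^ 3 = 1 := by
  decide

theorem norm_eq (z : EisensteinInt) : z.norm = z.re ^ 2 + z.re * z.im + z.im ^ 2 := by
  rw [norm_def]
  ring

theorem norm_nonneg (z : EisensteinInt) : 0 ≤ z.norm := by
  rw [norm_eq]
  nlinarith [sq_nonneg (z.re + z.im), sq_nonneg z.re, sq_nonneg z.im]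

theorem norm_eq_zero {z : EisensteinInt} : z.norm = 0 ↔ z = 0 := by
  constructor
  · intro h
    rw [norm_eq] at h
    have h1 : z.re ^ 2 = 0 := by
      nlinarith [sq_nonneg (z.re + z.im), sq_nonneg z.re, sq_nonneg z.im]
    have h2 : z.im ^ 2 = 0 := by
      nlinarith [sq_nonneg (z.re + z.im), sq_nonneg z.re, sq_nonneg z.im]
    ext
    · simpa using h1
    · simpa using h2
  · rintro rfl
    exact QuadraticAlgebra.norm_zero

theorem norm_pos {z : EisensteinInt} (hz : z ≠ 0) : 0 < z.norm :=
  lt_of_le_of_ne (norm_nonneg z) fun h => hz (norm_eq_zero.1 h.symm)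

instance : IsDomain EisensteinInt := by
  have : NoZeroDivisors EisensteinInt :=
    ⟨fun {a b} h => by
      have := congrArg QuadraticAlgebra.norm h
      rw [map_mul, QuadraticAlgebra.norm_zero, mul_eq_zero, norm_eq_zero, norm_eq_zero] at this
      exact this⟩
  exact NoZeroDivisors.to_isDomain _

/-- Euclidean division: rounding both coordinates of `a * star b / N(b)` to nearest integers leaves
coordinates of absolute value at most 1/2, where `r² + r s + s² ≤ 3/4`. -/
theorem exists_norm_sub_mul_lt (a : EisensteinInt) {b : EisensteinInt} (hb : b ≠ 0) :
    ∃ q : EisensteinInt, (a - b * q).norm < b.norm := by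
  have hN := norm_pos hb
  have hround : ∀ x : ℤ, ∃ y r : ℤ, x = b.norm * y + r ∧ 2 * r ≤ b.norm ∧ -b.norm ≤ 2 * r := by
    intro x
    refine ⟨(2 * x + b.norm) / (2 * b.norm), x - b.norm * ((2 * x + b.norm) / (2 * b.norm)),
      by ring, ?_, ?_⟩
    · have := Int.lt_mul_ediv_self_add (x := 2 * x + b.norm) (k := 2 * b.norm) (by linarith)
      linarith
    · have := Int.mul_ediv_self_le (x := 2 * x + b.norm) (k := 2 * b.norm) (by linarith)
      linarith
  obtain ⟨y, r, hy, hr, hr'⟩ := hround (a * star b).re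
  obtain ⟨z, s, hz, hs, hs'⟩ := hround (a * star b).im
  refine ⟨⟨y, z⟩, ?_⟩
  have h1 : (a - b * ⟨y, z⟩) * star b = ⟨r, s⟩ := by
    have : (a - b * ⟨y, z⟩) * star b = a * star b - algebraMap ℤ _ b.norm * ⟨y, z⟩ := by
      rw [algebraMap_norm_eq_mul_star]
      ring
    rw [this]
    ext
    · rw [re_sub, hy]
      simp
    · rw [im_sub, hz]
      simp
  have h2 := congrArg QuadraticAlgebra.norm h1
  rw [map_mul, QuadraticAlgebra.norm_star, norm_eq ⟨r, s⟩] at h2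
  dsimp only at h2
  have hr2 : 4 * r ^ 2 ≤ b.norm ^ 2 := by nlinarith
  have hs2 : 4 * s ^ 2 ≤ b.norm ^ 2 := by nlinarith
  have hrs : 8 * (r * s) ≤ 2 * b.norm ^ 2 := by nlinarith [sq_nonneg (r - s)]
  by_contra hcon
  have : b.norm * b.norm ≤ (a - b * ⟨y, z⟩).norm * b.norm :=
    mul_le_mul_of_nonneg_right (not_lt.1 hcon) hN.le
  nlinarith

instance : IsPrincipalIdealRing EisensteinInt := by
  refine ⟨fun I => ?_⟩
  by_cases hI : I = ⊥
  · rw [hI]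
    infer_instance
  obtain ⟨x, hxI, hx0⟩ := I.ne_bot_iff.1 hI
  let P : ℕ → Prop := fun n => ∃ b ∈ I, b ≠ 0 ∧ b.norm.natAbs = n
  have hP : ∃ n, P n := ⟨_, x, hxI, hx0, rfl⟩
  classical
  obtain ⟨b, hbI, hb0, hb⟩ := Nat.find_spec hP
  refine ⟨⟨b, le_antisymm (fun a ha => ?_) ?_⟩⟩
  · obtain ⟨q, hq⟩ := exists_norm_sub_mul_lt a hb0
    have hmem : a - b * q ∈ I := I.sub_mem ha (I.mul_mem_right q hbI)
    have h0 : a - b * q = 0 := by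
      by_contra hne
      have h1 := Nat.find_min' hP ⟨_, hmem, hne, rfl⟩
      have h2 := norm_nonneg (a - b * q)
      have h3 := norm_nonneg b
      omega
    exact Ideal.mem_span_singleton'.2 ⟨q, by rw [mul_comm]; exact (sub_eq_zero.1 h0).symm⟩
  · exact (Submodule.span_singleton_le_iff_mem _ _).2 hbI

/-- The principal ideal of multiples of `α`, as an additive subgroup. -/
def multiples (α : EisensteinInt) : AddSubgroup EisensteinInt :=
  (Ideal.span {α}).toAddSubgroup

theorem mem_multiples {α a : EisensteinInt} : a ∈ multiples α ↔ α ∣ a :=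
  Ideal.mem_span_singleton

theorem index_multiples (α : EisensteinInt) : (multiples α).index = α.norm.natAbs := by
  rw [← det_toLinearMap_eq_norm]
  exact Ideal.absNorm_span_singleton α

/-- As 1 and `ζ` span the ring over `ℤ`, a subgroup stable under `ζ` is an ideal, and all ideals are
principal. -/
theorem exists_eq_multiples {L : AddSubgroup EisensteinInt} (hL : ∀ a, zeta * a ∈ L ↔ a ∈ L) :
    ∃ α, L = multiples α := by
  have hmul : ∀ r a : EisensteinInt, a ∈ L → r * a ∈ L := by
    intro r a ha
    have : r * a = (r.re + r.im) • a + r.im • (zeta * a) := by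
      ext <;> simp [zeta] <;> ring
    rw [this]
    exact L.add_mem (L.zsmul_mem ha _) (L.zsmul_mem ((hL a).2 ha) _)
  let I : Ideal EisensteinInt := { L.toAddSubmonoid with smul_mem' := fun r a ha => hmul r a ha }
  obtain ⟨α, hα⟩ := (IsPrincipalIdealRing.principal I).principal
  refine ⟨α, ?_⟩
  ext a
  change a ∈ I ↔ a ∈ Submodule.span EisensteinInt {α}
  rw [hα]

theorem zeta_mul_mem_multiples (α a : EisensteinInt) :
    zeta * a ∈ multiples α ↔ a ∈ multiples α := by
  rw [mem_multiples, mem_multiples]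
  have hu : IsUnit zeta := IsUnit.of_pow_eq_one zeta_pow_three (by norm_num)
  exact hu.dvd_mul_left

/-- Additive subgroups of index `m` invariant under multiplication by `ζ`. -/
abbrev InvariantSubgroup (m : ℕ) : Type :=
  {L : AddSubgroup EisensteinInt // L.index = m ∧ ∀ a, zeta * a ∈ L ↔ a ∈ L}

theorem eq_of_norm_eq_one {u : EisensteinInt} (hu : u.norm = 1) :
    u = ⟨1, 0⟩ ∨ u = ⟨0, 1⟩ ∨ u = ⟨-1, 1⟩ ∨ u = ⟨-1, 0⟩ ∨ u = ⟨0, -1⟩ ∨ u = ⟨1, -1⟩ := by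
  obtain ⟨x, y⟩ := u
  rw [norm_eq] at hu
  dsimp only at hu
  have hx1 : x ≤ 1 := by nlinarith [sq_nonneg (x + 2 * y)]
  have hx2 : -1 ≤ x := by nlinarith [sq_nonneg (x + 2 * y)]
  have hy1 : y ≤ 1 := by nlinarith [sq_nonneg (2 * x + y)]
  have hy2 : -1 ≤ y := by nlinarith [sq_nonneg (2 * x + y)]
  interval_cases x <;> interval_cases y <;> simp_all

/-- The half-open sector of angle `π / 3` containing one associate of each nonzero element. -/
def sector (m : ℕ) : Set (ℤ × ℤ) :=
  {v : ℤ × ℤ | 0 < v.1 ∧ 0 ≤ v.2 ∧ v.1 ^ 2 + v.1 * v.2 + v.2 ^ 2 = (m : ℤ)}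

theorem finite_sector (m : ℕ) : (sector m).Finite := by
  refine (Set.finite_Icc ((0 : ℤ), (0 : ℤ)) (m, m)).subset ?_
  rintro ⟨p, q⟩ ⟨hp, hq, h⟩
  dsimp only at hp hq h
  refine ⟨⟨hp.le, hq⟩, ⟨?_, ?_⟩⟩
  · dsimp only
    nlinarith [mul_nonneg hp.le hq]
  · dsimp only
    rcases hq.eq_or_lt with h0 | h0
    · omega
    · nlinarith [mul_nonneg hp.le hq]

/-- Multiplication by the unit `ω` is rotation by `π / 3`, in coordinates `(p, q) ↦ (-q, p + q)`;
one of the six rotates of a nonzero point lies in the half-open sector. -/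
theorem exists_associate_mem_sector {α : EisensteinInt} (hα : α ≠ 0) :
    ∃ p q : ℤ, 0 < p ∧ 0 ≤ q ∧ Associated α ⟨p, q⟩ := by
  have hω : IsUnit (⟨0, 1⟩ : EisensteinInt) := by
    rw [isUnit_iff_norm_isUnit, norm_eq]
    norm_num
  have hstep : ∀ p q : ℤ, Associated (⟨p, q⟩ : EisensteinInt) ⟨-q, p + q⟩ := by
    intro p q
    refine ⟨hω.unit, ?_⟩
    ext <;> simp
  obtain ⟨p, q⟩ := α
  have h1 := hstep p q
  have h2 := h1.trans (hstep _ _)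
  have h3 := h2.trans (hstep _ _)
  have h4 := h3.trans (hstep _ _)
  have h5 := h4.trans (hstep _ _)
  have hpq : ¬ (p = 0 ∧ q = 0) := by
    rintro ⟨rfl, rfl⟩
    exact hα rfl
  have : (0 < p ∧ 0 ≤ q) ∨ (0 < -q ∧ 0 ≤ p + q) ∨ (0 < -(p + q) ∧ 0 ≤ -q + (p + q)) ∨
      (0 < -(-q + (p + q)) ∧ 0 ≤ -(p + q) + (-q + (p + q))) ∨
      (0 < -(-(p + q) + (-q + (p + q))) ∧
        0 ≤ -(-q + (p + q)) + (-(p + q) + (-q + (p + q)))) ∨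
      (0 < -(-(-q + (p + q)) + (-(p + q) + (-q + (p + q)))) ∧
        0 ≤ -(-(p + q) + (-q + (p + q))) +
          (-(-q + (p + q)) + (-(p + q) + (-q + (p + q))))) := by
    omega
  rcases this with h | h | h | h | h | h
  · exact ⟨p, q, h.1, h.2, Associated.refl _⟩
  · exact ⟨_, _, h.1, h.2, h1⟩
  · exact ⟨_, _, h.1, h.2, h2⟩
  · exact ⟨_, _, h.1, h.2, h3⟩
  · exact ⟨_, _, h.1, h.2, h4⟩
  · exact ⟨_, _, h.1, h.2, h5⟩

/-- The units are the six elements of norm 1, and each of them except 1 rotates the sector off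
itself. -/
theorem eq_of_associated_of_mem_sector {p q p' q' : ℤ} (hp : 0 < p) (hq : 0 ≤ q) (hp' : 0 < p')
    (hq' : 0 ≤ q') (h : Associated (⟨p, q⟩ : EisensteinInt) ⟨p', q'⟩) : p = p' ∧ q = q' := by
  obtain ⟨u, hu⟩ := h
  have hN : (u : EisensteinInt).norm = 1 := by
    have h1 := isUnit_iff_norm_isUnit.1 u.isUnit
    rcases Int.isUnit_iff.1 h1 with h2 | h2
    · exact h2
    · have := norm_nonneg (u : EisensteinInt)
      omega
  have h1 := congrArg QuadraticAlgebra.re hu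
  have h2 := congrArg QuadraticAlgebra.im hu
  rcases eq_of_norm_eq_one hN with h | h | h | h | h | h <;> rw [h] at h1 h2 <;>
    simp at h1 h2 <;> omega

/-- Every ideal of norm `m` has exactly one generator in the sector. -/
theorem nonempty_sector_equiv {m : ℕ} (hm : 0 < m) :
    Nonempty (sector m ≃ InvariantSubgroup m) := by
  refine ⟨Equiv.ofBijective (fun v => ⟨multiples ⟨v.1.1, v.1.2⟩, ?_,
    zeta_mul_mem_multiples _⟩) ⟨?_, ?_⟩⟩
  · rw [index_multiples, norm_eq]
    dsimp only
    rw [v.2.2.2, Int.natAbs_natCast]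
  · rintro ⟨⟨p, q⟩, hp, hq, h⟩ ⟨⟨p', q'⟩, hp', hq', h'⟩ heq
    have heq := Subtype.ext_iff.1 heq
    dsimp only at heq hp hp' hq hq'
    have hass : Associated (⟨p, q⟩ : EisensteinInt) ⟨p', q'⟩ := by
      refine associated_of_dvd_dvd ?_ ?_
      · rw [← mem_multiples, heq, mem_multiples]
      · rw [← mem_multiples, ← heq, mem_multiples]
    obtain ⟨rfl, rfl⟩ := eq_of_associated_of_mem_sector hp hq hp' hq' hass
    rfl
  · rintro ⟨L, hLm, hL⟩
    obtain ⟨α, rfl⟩ := exists_eq_multiples hL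
    rw [index_multiples] at hLm
    have hα : α ≠ 0 := by
      rintro rfl
      rw [QuadraticAlgebra.norm_zero] at hLm
      simp at hLm
      omega
    obtain ⟨p, q, hp, hq, hass⟩ := exists_associate_mem_sector hα
    have heq : multiples α = multiples ⟨p, q⟩ := by
      ext a
      rw [mem_multiples, mem_multiples, hass.dvd_iff_dvd_left]
    refine ⟨⟨(p, q), hp, hq, ?_⟩, Subtype.ext heq.symm⟩
    have h1 := index_multiples (⟨p, q⟩ : EisensteinInt)
    rw [← heq, index_multiples, hLm] at h1
    have h2 := norm_nonneg (⟨p, q⟩ : EisensteinInt)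
    have h3 := norm_eq (⟨p, q⟩ : EisensteinInt)
    dsimp only at h3
    dsimp only
    omega

theorem finite_invariantSubgroup {m : ℕ} (hm : 0 < m) : Finite (InvariantSubgroup m) := by
  obtain ⟨e⟩ := nonempty_sector_equiv hm
  have := (finite_sector m).to_subtype
  exact Finite.of_equiv _ e

theorem card_invariantSubgroup {m : ℕ} (hm : 0 < m) : Nat.card (InvariantSubgroup m) = theta m := by
  obtain ⟨e⟩ := nonempty_sector_equiv hm
  rw [← Nat.card_congr e]
  rfl

theorem norm_one_sub_zeta : (1 - zeta).norm = 3 := by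
  rw [norm_eq]
  simp [zeta]

/-- The norm is congruent to `(re - im)²` modulo 3. So `re - im = 3 x` for some `x`, and solving for
the quotient by `1 - ζ = 2 - ω` gives `x + (im + x) ω`. -/
theorem one_sub_zeta_dvd {α : EisensteinInt} (h : 3 ∣ α.norm) : 1 - zeta ∣ α := by
  rw [norm_eq] at h
  have h1 : (3 : ℤ) ∣ (α.re - α.im) ^ 2 := by
    have : (α.re - α.im) ^ 2 = α.re ^ 2 + α.re * α.im + α.im ^ 2 - 3 * (α.re * α.im) := by ring
    rw [this]
    exact dvd_sub h (dvd_mul_right _ _)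
  obtain ⟨x, hx⟩ := Int.prime_three.dvd_of_dvd_pow h1
  refine ⟨⟨x, α.im + x⟩, ?_⟩
  ext
  · simp [zeta]
    linarith
  · simp [zeta]
    linarith

/-- The ideal `(1 - ζ)` has prime index 3: it contains the ideal `L` when `3 ∣ m`, and otherwise the
index of the sum divides both 3 and `m`. -/
theorem index_sup_multiples {m : ℕ} (L : InvariantSubgroup m) :
    (L.1 ⊔ multiples (1 - zeta)).index = if 3 ∣ m then 3 else 1 := by
  obtain ⟨L, hLm, hL⟩ := L
  obtain ⟨α, rfl⟩ := exists_eq_multiples hL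
  have h3 : (multiples (1 - zeta)).index = 3 := by
    rw [index_multiples, norm_one_sub_zeta]
    rfl
  rw [index_multiples] at hLm
  dsimp only
  split_ifs with h
  · have hdvd : 1 - zeta ∣ α := one_sub_zeta_dvd (by omega)
    rw [sup_eq_right.2, h3]
    intro a ha
    rw [mem_multiples] at ha ⊢
    exact hdvd.trans ha
  · have h1 : (multiples α ⊔ multiples (1 - zeta)).index ∣ 3 := by
      rw [← h3]
      exact AddSubgroup.index_dvd_of_le le_sup_right
    have h2 : (multiples α ⊔ multiples (1 - zeta)).index ∣ m := by
      rw [← hLm, ← index_multiples]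
      exact AddSubgroup.index_dvd_of_le le_sup_left
    rcases (Nat.dvd_prime Nat.prime_three).1 h1 with h4 | h4
    · exact h4
    · exact absurd (h4 ▸ h2) h

/-- Multiplication by `1 - ζ`, the only prime above 3, is a bijection from ideals of norm `k` to
ideals of norm `3 k`. -/
theorem theta_three_mul {k : ℕ} (hk : 0 < k) : theta (3 * k) = theta k := by
  rw [← card_invariantSubgroup hk, ← card_invariantSubgroup (by omega : 0 < 3 * k)]
  have h0 : (1 - zeta : EisensteinInt) ≠ 0 := by
    intro h
    have := norm_one_sub_zeta
    rw [h, QuadraticAlgebra.norm_zero] at this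
    omega
  have hmap : ∀ α, (multiples α).map (AddMonoidHom.mulLeft (1 - zeta)) =
      multiples ((1 - zeta) * α) := by
    intro α
    ext a
    rw [mem_multiples, AddSubgroup.mem_map]
    constructor
    · rintro ⟨b, hb, rfl⟩
      exact mul_dvd_mul_left _ (mem_multiples.1 hb)
    · rintro ⟨c, rfl⟩
      exact ⟨α * c, mem_multiples.2 (dvd_mul_right _ _), by simp [mul_assoc]⟩
  symm
  refine Nat.card_congr (Equiv.ofBijective (fun L =>
    ⟨L.1.map (AddMonoidHom.mulLeft (1 - zeta)), ?_⟩) ⟨?_, ?_⟩)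
  · obtain ⟨L, hLm, hL⟩ := L
    obtain ⟨α, rfl⟩ := exists_eq_multiples hL
    rw [hmap]
    refine ⟨?_, zeta_mul_mem_multiples _⟩
    rw [index_multiples, map_mul, norm_one_sub_zeta, Int.natAbs_mul, ← index_multiples, hLm]
    rfl
  · rintro ⟨L, hL⟩ ⟨L', hL'⟩ h
    have h := Subtype.ext_iff.1 h
    refine Subtype.ext (AddSubgroup.map_injective (fun a b hab => ?_) h)
    exact mul_left_cancel₀ h0 hab
  · rintro ⟨L, hLm, hL⟩
    obtain ⟨α, rfl⟩ := exists_eq_multiples hL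
    rw [index_multiples] at hLm
    obtain ⟨β, rfl⟩ := one_sub_zeta_dvd (α := α) (by omega)
    refine ⟨⟨multiples β, ?_, zeta_mul_mem_multiples _⟩, Subtype.ext (hmap β)⟩
    rw [map_mul, norm_one_sub_zeta, Int.natAbs_mul] at hLm
    rw [index_multiples]
    exact Nat.eq_of_mul_eq_mul_left (by norm_num) hLm

end EisensteinInt

/-! ### Multiplication by `ζ` and the embedding of the Eisenstein integers in `ℂ`. -/

namespace EisensteinInt

/-- The cube root of unity `ζ` as a unit. -/
def zetaUnit : EisensteinIntˣ :=
  ⟨zeta, zeta ^ 2, zeta_pow_three, zeta_pow_three⟩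

theorem zetaUnit_pow_three : zetaUnit ^ 3 = 1 :=
  Units.ext zeta_pow_three

/-- Multiplication by `ζ`. -/
def zetaMul : EisensteinInt ≃ₗ[ℤ] EisensteinInt where
  toFun a := zeta * a
  invFun a := zeta ^ 2 * a
  map_add' := mul_add _
  map_smul' m a := mul_smul_comm m _ a
  left_inv a := by
    change zeta ^ 2 * (zeta * a) = a
    rw [← mul_assoc, ← pow_succ, zeta_pow_three, one_mul]
  right_inv a := by
    change zeta * (zeta ^ 2 * a) = a
    rw [← mul_assoc, ← pow_succ', zeta_pow_three, one_mul]

theorem zetaMul_apply (a : EisensteinInt) : zetaMul a = zeta * a := rfl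

theorem zetaMul_zpow_apply (k : ℤ) (a : EisensteinInt) :
    (zetaMul ^ k) a = ((zetaUnit ^ k : EisensteinIntˣ) : EisensteinInt) * a := by
  induction k generalizing a with
  | zero => simp
  | succ i ih =>
    rw [LinearEquiv.zpow_add_apply, zpow_one, zetaMul_apply, ih, zpow_add, zpow_one,
      Units.val_mul, mul_assoc]
    rfl
  | pred i ih =>
    obtain ⟨b, rfl⟩ := zetaMul.surjective a
    have h := LinearEquiv.zpow_add_apply zetaMul (-(i : ℤ) - 1) 1 b
    rw [sub_add_cancel, zpow_one] at h
    rw [← h, ih, zetaMul_apply, ← mul_assoc]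
    congr 1
    have : zetaUnit ^ (-(i : ℤ)) = zetaUnit ^ (-(i : ℤ) - 1) * zetaUnit := by
      rw [zpow_sub_one, inv_mul_cancel_right]
    rw [this]
    rfl

theorem zetaUnit_zpow_emod (k : ℤ) : zetaUnit ^ k = zetaUnit ^ (k % 3) := by
  conv_lhs => rw [← Int.mul_ediv_add_emod k 3, zpow_add, zpow_mul]
  have : zetaUnit ^ (3 : ℤ) = 1 := zetaUnit_pow_three
  rw [this, one_zpow, one_mul]

theorem zetaMul_zpow_of_dvd {k : ℤ} (hk : 3 ∣ k) (a : EisensteinInt) : (zetaMul ^ k) a = a := by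
  rw [zetaMul_zpow_apply, zetaUnit_zpow_emod, Int.emod_eq_zero_of_dvd hk, zpow_zero, Units.val_one,
    one_mul]

end EisensteinInt

open EisensteinInt

theorem coe_cubeRoot : (cubeRoot : ℂ) = ⟨-1 / 2, √3 / 2⟩ := by
  have h : (2 * Real.pi / 3) = Real.pi - Real.pi / 3 := by ring
  rw [cubeRoot, Circle.coe_exp]
  apply Complex.ext
  · rw [Complex.exp_ofReal_mul_I_re, h, Real.cos_pi_sub, Real.cos_pi_div_three]
    norm_num
  · rw [Complex.exp_ofReal_mul_I_im, h, Real.sin_pi_sub, Real.sin_pi_div_three]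

theorem cubeRoot_sq_add : (cubeRoot : ℂ) ^ 2 + cubeRoot + 1 = 0 := by
  have h3 : √3 * √3 = 3 := Real.mul_self_sqrt (by norm_num)
  rw [coe_cubeRoot]
  apply Complex.ext
  · simp [sq]
    nlinarith
  · simp [sq]
    ring

theorem cubeRoot_pow_three : (cubeRoot : ℂ) ^ 3 = 1 := by
  linear_combination ((cubeRoot : ℂ) - 1) * cubeRoot_sq_add

theorem cubeRoot_ne_one : (cubeRoot : ℂ) ≠ 1 := by
  intro h
  have := cubeRoot_sq_add
  rw [h] at this
  norm_num at this

theorem cubeRoot_ne_zero : (cubeRoot : ℂ) ≠ 0 := Circle.coe_ne_zero _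

theorem cubeRoot_zpow_emod (k : ℤ) : (cubeRoot : ℂ) ^ k = (cubeRoot : ℂ) ^ (k % 3) := by
  conv_lhs => rw [← Int.mul_ediv_add_emod k 3, zpow_add₀ cubeRoot_ne_zero, zpow_mul]
  have : (cubeRoot : ℂ) ^ (3 : ℤ) = 1 := cubeRoot_pow_three
  rw [this, one_zpow, one_mul]

namespace EisensteinInt

/-- The embedding of the Eisenstein integers into the complex numbers. -/
noncomputable def toComplex : EisensteinInt →+* ℂ where
  -- The basis element `ω` goes to `exp (π i / 3) = 1 + exp (2 π i / 3)`.
  toFun z := z.re + z.im * (1 + cubeRoot)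
  map_one' := by simp [QuadraticAlgebra.re_one, QuadraticAlgebra.im_one]
  map_zero' := by simp
  map_add' a b := by
    simp only [QuadraticAlgebra.re_add, QuadraticAlgebra.im_add]
    push_cast
    ring
  map_mul' a b := by
    simp only [QuadraticAlgebra.re_mul, QuadraticAlgebra.im_mul]
    push_cast
    linear_combination (-(a.im : ℂ) * b.im) * cubeRoot_sq_add

theorem toComplex_apply (z : EisensteinInt) : toComplex z = z.re + z.im * (1 + cubeRoot) := rfl

theorem toComplex_zeta : toComplex zeta = cubeRoot := by
  rw [toComplex_apply, zeta]
  push_cast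
  ring

theorem normSq_toComplex (z : EisensteinInt) : Complex.normSq (toComplex z) = z.norm := by
  have h3 : √3 * √3 = 3 := Real.mul_self_sqrt (by norm_num)
  rw [toComplex_apply, coe_cubeRoot, Complex.normSq_apply, norm_eq]
  simp
  nlinarith

theorem one_le_norm_toComplex {z : EisensteinInt} (hz : z ≠ 0) : 1 ≤ ‖toComplex z‖ := by
  have h : (1 : ℝ) ≤ z.norm := by exact_mod_cast norm_pos hz
  rw [← normSq_toComplex, Complex.normSq_eq_norm_sq] at h
  nlinarith [_root_.norm_nonneg (toComplex z)]

theorem toComplex_ne_zero {z : EisensteinInt} (hz : z ≠ 0) : toComplex z ≠ 0 := by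
  intro h
  have := one_le_norm_toComplex hz
  rw [h, _root_.norm_zero] at this
  linarith

theorem toComplex_zetaMul_zpow (k : ℤ) (a : EisensteinInt) :
    toComplex ((zetaMul ^ k) a) = (cubeRoot : ℂ) ^ k * toComplex a := by
  rw [zetaMul_zpow_apply, map_mul]
  congr 1
  have h := congrArg Units.val (map_zpow (Units.map toComplex.toMonoidHom) zetaUnit k)
  rw [Units.val_zpow_eq_zpow_val] at h
  have h2 : ((Units.map toComplex.toMonoidHom zetaUnit : ℂˣ) : ℂ) = cubeRoot := toComplex_zeta
  rw [h2] at h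
  exact h

end EisensteinInt

/-! ### The action on `ℂ × ℝ` and the fundamental group of the tricosm. -/

/-- The abstract form `ℤ[ζ] ⋊ ℤ` of the fundamental group of the tricosm. -/
abbrev TricosmModel : Type := TwistedProduct zetaMul

namespace TricosmModel

noncomputable instance : MulAction TricosmModel (ℂ × ℝ) where
  smul x e := ((cubeRoot : ℂ) ^ x.deg * e.1 + toComplex x.base, e.2 + x.deg)
  one_smul e := by
    change ((cubeRoot : ℂ) ^ (0 : ℤ) * e.1 + toComplex 0, e.2 + ((0 : ℤ) : ℝ)) = e
    simp
  mul_smul x y e := by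
    change ((cubeRoot : ℂ) ^ (x.deg + y.deg) * e.1 +
        toComplex (x.base + (zetaMul ^ x.deg) y.base), e.2 + ((x.deg + y.deg : ℤ) : ℝ)) =
      ((cubeRoot : ℂ) ^ x.deg * ((cubeRoot : ℂ) ^ y.deg * e.1 + toComplex y.base) +
        toComplex x.base, e.2 + y.deg + x.deg)
    rw [map_add, toComplex_zetaMul_zpow, zpow_add₀ cubeRoot_ne_zero]
    ext1
    · dsimp only
      ring
    · push_cast
      ring

theorem smul_def (x : TricosmModel) (e : ℂ × ℝ) :
    x • e = ((cubeRoot : ℂ) ^ x.deg * e.1 + toComplex x.base, e.2 + x.deg) := rfl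

instance : ContinuousConstSMul TricosmModel (ℂ × ℝ) where
  continuous_const_smul x := by
    simp only [smul_def]
    fun_prop

/-- An element of nonzero degree moves the real coordinate by at least 1, and one of degree 0
translates `ℂ` by an Eisenstein integer, of length at least 1 unless it is zero. Freeness, proper
discontinuity and discreteness of the lattices below all come from this bound. -/
theorem eq_one_of_dist_smul_lt {x : TricosmModel} {e : ℂ × ℝ} (h : dist (x • e) e < 1) :
    x = 1 := by
  rw [smul_def, Prod.dist_eq, max_lt_iff] at h
  obtain ⟨h1, h2⟩ := h
  dsimp only at h1 h2
  have hd : x.deg = 0 := by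
    rw [Real.dist_eq, add_sub_cancel_left] at h2
    have : |x.deg| < 1 := by exact_mod_cast h2
    exact Int.abs_lt_one_iff.1 this
  rw [hd, zpow_zero, one_mul, dist_eq_norm, add_sub_cancel_left] at h1
  have hb : x.base = 0 := by
    by_contra hne
    linarith [one_le_norm_toComplex hne]
  ext1
  · exact hb
  · exact hd

theorem closure_generators : Subgroup.closure
    ({⟨1, 0⟩, ⟨zeta, 0⟩, ⟨0, 1⟩} : Set TricosmModel) = ⊤ := by
  rw [eq_top_iff]
  intro x _
  set C := Subgroup.closure ({⟨1, 0⟩, ⟨zeta, 0⟩, ⟨0, 1⟩} : Set TricosmModel)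
  have h1 : (1 : EisensteinInt) ∈ TwistedProduct.fib C := Subgroup.subset_closure (by simp)
  have h2 : zeta ∈ TwistedProduct.fib C := Subgroup.subset_closure (by simp)
  have h3 : (⟨0, 1⟩ : TricosmModel) ∈ C := Subgroup.subset_closure (by simp)
  have h4 : x.base ∈ TwistedProduct.fib C := by
    have : x.base = (x.base.re + x.base.im) • (1 : EisensteinInt) + x.base.im • zeta := by
      ext <;> simp [zeta]
    rw [this]
    exact AddSubgroup.add_mem _ (AddSubgroup.zsmul_mem _ h1 _) (AddSubgroup.zsmul_mem _ h2 _)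
  have h5 : ∀ j : ℤ, (⟨0, 1⟩ : TricosmModel) ^ j = ⟨0, j⟩ := by
    let f : Multiplicative ℤ →* TricosmModel :=
      { toFun := fun j => ⟨0, j.toAdd⟩
        map_one' := rfl
        map_mul' := fun i j => by ext1 <;> simp }
    intro j
    have := map_zpow f (Multiplicative.ofAdd 1) j
    rw [← ofAdd_zsmul, smul_eq_mul, mul_one] at this
    exact this.symm
  have h6 : x = (⟨x.base, 0⟩ : TricosmModel) * ⟨0, 1⟩ ^ x.deg := by
    rw [h5]
    ext1 <;> simp
  rw [h6]
  exact C.mul_mem h4 (C.zpow_mem h3 _)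

/-- The action homomorphism carries generators of the model to the three given motions, so its range
is `tricosmGroup` and the orbits coincide. -/
theorem exists_mem_tricosmGroup_iff (v w : ℂ × ℝ) :
    (∃ g ∈ tricosmGroup, g v = w) ↔ ∃ x : TricosmModel, x • v = w := by
  let Φ : TricosmModel →* ((ℂ × ℝ) ≃ₜ (ℂ × ℝ)) :=
    { toFun := Homeomorph.smul
      map_one' := by
        ext1 e
        exact one_smul TricosmModel e
      map_mul' := fun x y => by
        ext1 e
        exact mul_smul x y e }
  have hΦ : ∀ x e, Φ x e = x • e := fun _ _ => rfl
  have hX : Φ ⟨1, 0⟩ = isoX := by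
    ext1 e
    rw [hΦ, smul_def]
    ext1
    · simp [isoX]
    · simp [isoX]
  have hY : Φ ⟨zeta, 0⟩ = isoY := by
    ext1 e
    rw [hΦ, smul_def]
    ext1
    · simp [isoY, toComplex_zeta]
    · simp [isoY]
  have hZ : Φ ⟨0, 1⟩ = isoZ := by
    ext1 e
    rw [hΦ, smul_def]
    ext1
    · simp [isoZ, rotation_apply]
    · simp [isoZ]
  have hr : tricosmGroup = Φ.range := by
    rw [MonoidHom.range_eq_map, ← closure_generators, MonoidHom.map_closure, tricosmGroup]
    congr 1
    simp [Set.image_insert_eq, hX, hY, hZ]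
  rw [hr]
  constructor
  · rintro ⟨_, ⟨x, rfl⟩, h⟩
    exact ⟨x, h⟩
  · rintro ⟨x, h⟩
    exact ⟨_, ⟨x, rfl⟩, h⟩

theorem isQuotientCoveringMap_tricosm :
    IsQuotientCoveringMap (Quotient.mk tricosmSetoid) TricosmModel where
  __ := isQuotientMap_quotient_mk'
  apply_eq_iff_mem_orbit {e₁ e₂} := by
    rw [eq_comm, Quotient.eq, MulAction.mem_orbit_iff]
    exact exists_mem_tricosmGroup_iff e₂ e₁
  disjoint e := by
    -- If `a` and `x • a` both lie within 1/2 of `e`, then `x` moves `a` by less than 1.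
    refine ⟨Metric.ball e (1 / 2), Metric.ball_mem_nhds e (by norm_num), ?_⟩
    rintro x ⟨_, ⟨a, ha, rfl⟩, hb⟩
    refine eq_one_of_dist_smul_lt (e := a) ?_
    have h1 := Metric.mem_ball.1 ha
    have h2 := Metric.mem_ball.1 hb
    linarith [dist_triangle_right (x • a) a e]

/-- The fundamental group of the tricosm. -/
theorem nonempty_fundamentalGroup_mulEquiv (x : Tricosm) :
    Nonempty (FundamentalGroup Tricosm x ≃* TricosmModel) := by
  obtain ⟨e, he⟩ := isQuotientCoveringMap_tricosm.surjective x
  -- The covering equivalence takes values in the opposite group; inversion removes the reversal.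
  exact ⟨(isQuotientCoveringMap_tricosm.fundamentalGroupEquiv ⟨e, he⟩).trans
    (MulEquiv.inv' _).symm⟩

end TricosmModel

/-! ### Isomorphism type and orbit space of a subgroup of finite index. -/

open EisensteinInt TwistedProduct

/-- A lattice in a three-dimensional real vector space has the 3-torus as quotient. -/
theorem ZLattice.exists_isQuotientMap_torus {E : Type*} [NormedAddCommGroup E] [NormedSpace ℝ E]
    [FiniteDimensional ℝ E] (hE : Module.finrank ℝ E = 3) (L : Submodule ℤ E)
    [DiscreteTopology L] [IsZLattice ℝ L] :
    Nonempty (L ≃+ (Fin 3 → ℤ)) ∧ ∃ g : E → Torus3, Topology.IsQuotientMap g ∧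
      ∀ a b, g a = g b ↔ a - b ∈ L := by
  have : Module.Finite ℤ L := ZLattice.module_finite ℝ L
  have : Module.Free ℤ L := ZLattice.module_free ℝ L
  let b : Module.Basis (Fin 3) ℤ L :=
    Module.finBasisOfFinrankEq ℤ L ((ZLattice.rank ℝ L).trans hE)
  refine ⟨⟨b.equivFun.toAddEquiv⟩, ?_⟩
  let b' := b.ofZLatticeBasis ℝ L
  refine ⟨fun e i => (b'.equivFunL e i : UnitAddCircle), ?_, fun x y => ?_⟩
  · have h : IsOpenQuotientMap (Pi.map fun (_ : Fin 3) (r : ℝ) => (r : UnitAddCircle)) :=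
      IsOpenQuotientMap.piMap fun _ => QuotientAddGroup.isOpenQuotientMap_mk
    exact h.isQuotientMap.comp b'.equivFunL.toHomeomorph.isQuotientMap
  · have h2 := b'.mem_span_iff_repr_mem ℤ (x - y)
    rw [b.ofZLatticeBasis_span ℝ L] at h2
    rw [h2, funext_iff]
    refine forall_congr' fun i => ?_
    rw [eq_comm, QuotientAddGroup.eq, AddSubgroup.mem_zmultiples_iff]
    simp only [Module.Basis.equivFunL_apply, map_sub, Finsupp.coe_sub, Pi.sub_apply,
      Set.mem_range, zsmul_eq_mul, mul_one, neg_add_eq_sub]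
    rfl

namespace TricosmModel

variable {S : Subgroup TricosmModel}

theorem smul_of_dvd {x : TricosmModel} (h : 3 ∣ x.deg) (e : ℂ × ℝ) :
    x • e = (toComplex x.base, (x.deg : ℝ)) + e := by
  rw [smul_def, cubeRoot_zpow_emod, Int.emod_eq_zero_of_dvd h, zpow_zero, one_mul]
  ext1
  · simp [add_comm]
  · simp [add_comm]

theorem dvd_deg_of_mem (h3 : 3 ∣ degree S) {x : TricosmModel} (hx : x ∈ S) : 3 ∣ x.deg :=
  (Int.natCast_dvd_natCast.2 h3).trans (degree_dvd_of_mem hx)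

/-- The lattice of translation vectors of a subgroup consisting of translations. -/
def translationLattice (S : Subgroup TricosmModel) (h3 : 3 ∣ degree S) :
    Submodule ℤ (ℂ × ℝ) :=
  AddSubgroup.toIntSubmodule
    { carrier := {e | ∃ x ∈ S, (toComplex x.base, (x.deg : ℝ)) = e}
      zero_mem' := ⟨1, S.one_mem, by ext1 <;> simp⟩
      add_mem' := by
        rintro _ _ ⟨x, hx, rfl⟩ ⟨y, hy, rfl⟩
        refine ⟨x * y, S.mul_mem hx hy, ?_⟩
        rw [mul_base, mul_deg, zetaMul_zpow_of_dvd (dvd_deg_of_mem h3 hx)]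
        ext1 <;> simp
      neg_mem' := by
        rintro _ ⟨x, hx, rfl⟩
        refine ⟨x⁻¹, S.inv_mem hx, ?_⟩
        rw [inv_base, inv_deg, zetaMul_zpow_of_dvd (dvd_neg.2 (dvd_deg_of_mem h3 hx))]
        ext1 <;> simp }

theorem mem_translationLattice {h3 : 3 ∣ degree S} {e : ℂ × ℝ} :
    e ∈ translationLattice S h3 ↔ ∃ x ∈ S, (toComplex x.base, (x.deg : ℝ)) = e := Iff.rfl

instance (h3 : 3 ∣ degree S) : DiscreteTopology (translationLattice S h3) := by
  refine DiscreteTopology.of_forall_le_norm (r := 1) one_pos ?_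
  rintro ⟨_, x, hx, rfl⟩ hne
  by_contra hcon
  refine hne (Subtype.ext ?_)
  have h := eq_one_of_dist_smul_lt (x := x) (e := 0) (by
    rw [smul_of_dvd (dvd_deg_of_mem h3 hx), dist_eq_norm, add_zero, sub_zero]
    exact not_le.1 hcon)
  subst h
  ext1 <;> simp

/-- Finite index puts `m ℤ[ζ]` inside `fib S` for some `m ≠ 0`, which spans `ℂ × 0` over `ℝ`; an
element of degree `degree S ≠ 0` supplies the remaining direction. -/
theorem isZLattice_translationLattice (h3 : 3 ∣ degree S) (hS : S.index ≠ 0) :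
    IsZLattice ℝ (translationLattice S h3) := by
  refine ⟨?_⟩
  rw [index_eq_degree_mul, mul_ne_zero_iff] at hS
  obtain ⟨hd, hm⟩ := hS
  set V := Submodule.span ℝ (translationLattice S h3 : Set (ℂ × ℝ)) with hV
  set m := (fib S).index with hmdef
  have hsmul : ∀ a : EisensteinInt, (toComplex a, (0 : ℝ)) ∈ V := by
    intro a
    have h1 : m • a ∈ fib S := AddSubgroup.nsmul_index_mem _ _
    have h2 : (toComplex (m • a), (0 : ℝ)) ∈ V :=
      Submodule.subset_span ⟨⟨m • a, 0⟩, h1, by simp⟩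
    have hm' : (m : ℝ) ≠ 0 := Nat.cast_ne_zero.2 hm
    have h3 : (toComplex a, (0 : ℝ)) = (m : ℝ)⁻¹ • (toComplex (m • a), (0 : ℝ)) := by
      rw [map_nsmul]
      ext1
      · simp [hm]
      · simp
    rw [h3]
    exact V.smul_mem _ h2
  have hC : ∀ u : ℂ, (u, (0 : ℝ)) ∈ V := by
    intro u
    have hs : √3 ≠ 0 := by positivity
    have h1 := V.add_mem (V.smul_mem (u.re + u.im / √3) (hsmul 1))
      (V.smul_mem (2 * u.im / √3) (hsmul zeta))
    convert h1 using 1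
    rw [map_one, toComplex_zeta, coe_cubeRoot]
    ext1
    · apply Complex.ext
      · simp
        field_simp
        ring
      · simp
        field_simp
    · simp
  obtain ⟨v, hv⟩ := exists_mem_degree S
  have hv' : (toComplex v, (degree S : ℝ)) ∈ V := Submodule.subset_span ⟨_, hv, by simp⟩
  rw [eq_top_iff]
  rintro ⟨u, t⟩ -
  have hd' : (degree S : ℝ) ≠ 0 := Nat.cast_ne_zero.2 hd
  have h1 := V.add_mem (V.smul_mem (t / degree S) hv')
    (hC (u - ((t / degree S : ℝ) : ℂ) * toComplex v))
  convert h1 using 1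
  ext1
  · simp
  · simp [hd']

theorem finrank_complex_prod_real : Module.finrank ℝ (ℂ × ℝ) = 3 := by
  simp

theorem of_three_dvd_degree (h3 : 3 ∣ degree S) (hS : S.index ≠ 0) :
    Nonempty (S ≃* Multiplicative (Fin 3 → ℤ)) ∧
      Nonempty (Quotient (MulAction.orbitRel S (ℂ × ℝ)) ≃ₜ Torus3) := by
  have := isZLattice_translationLattice h3 hS
  obtain ⟨⟨e⟩, g, hg, hgL⟩ :=
    ZLattice.exists_isQuotientMap_torus finrank_complex_prod_real (translationLattice S h3)
  constructor
  · let f : S →* Multiplicative (translationLattice S h3) :=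
      { toFun := fun x => Multiplicative.ofAdd ⟨_, x.1, x.2, rfl⟩
        map_one' := by
          refine congrArg Multiplicative.ofAdd (Subtype.ext ?_)
          ext1 <;> simp
        map_mul' := fun x y => by
          refine congrArg Multiplicative.ofAdd (Subtype.ext ?_)
          dsimp only
          rw [Subgroup.coe_mul, mul_base, mul_deg, zetaMul_zpow_of_dvd (dvd_deg_of_mem h3 x.2)]
          ext1 <;> simp }
    have hf : Function.Bijective f := by
      constructor
      · rw [injective_iff_map_eq_one]
        intro x hx
        have h0 : (toComplex x.1.base, (x.1.deg : ℝ)) = 0 :=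
          Subtype.ext_iff.1 (congrArg Multiplicative.toAdd hx)
        refine Subtype.ext (eq_one_of_dist_smul_lt (e := 0) ?_)
        rw [smul_of_dvd (dvd_deg_of_mem h3 x.2), h0]
        simp
      · rintro ⟨_, x, hx, rfl⟩
        exact ⟨⟨x, hx⟩, rfl⟩
    exact ⟨(MulEquiv.ofBijective f hf).trans (AddEquiv.toMultiplicative e)⟩
  · obtain ⟨h, -⟩ := exists_homeomorph_of_isQuotientMap
      (isQuotientCoveringMap_tricosm.mk_subgroup S).toIsQuotientMap hg (fun a b => by
        rw [hgL, IsQuotientCoveringMap.mk_eq_mk_iff, mem_translationLattice]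
        refine exists_congr fun x => and_congr_right fun hx => ?_
        rw [smul_of_dvd (dvd_deg_of_mem h3 hx), eq_sub_iff_add_eq])
    exact ⟨h⟩

/-- The map `F (u, t) = (α u + w, m t)` conjugates Γ onto `S`. Here `α` generates the ideal `fib S`,
`m = ± degree S`, and `w` is the centre of a screw motion `(v, m) ∈ S`. Translation by `a` becomes
translation by `α a`, and `(0, 1)` becomes `(v, m)`. -/
theorem of_not_three_dvd_degree (h3 : ¬ 3 ∣ degree S) (hS : S.index ≠ 0) :
    Nonempty (S ≃* TricosmModel) ∧
      Nonempty (Quotient (MulAction.orbitRel S (ℂ × ℝ)) ≃ₜ Tricosm) := by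
  rw [index_eq_degree_mul, mul_ne_zero_iff] at hS
  obtain ⟨hd, hm⟩ := hS
  -- The sign is chosen so that `ζ ^ m = ζ`. A negative `m` does no harm: `F` then reverses the real
  -- axis but is still a homeomorphism.
  obtain ⟨m, hmd, hm3⟩ : ∃ m : ℤ, (degree S : ℤ) ∣ m ∧ (m ∣ degree S ∧ m % 3 = 1) := by
    rcases (by omega : degree S % 3 = 1 ∨ degree S % 3 = 2) with h | h
    · exact ⟨degree S, dvd_rfl, dvd_rfl, by omega⟩
    · exact ⟨-degree S, dvd_neg.2 dvd_rfl, neg_dvd.2 dvd_rfl, by omega⟩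
  obtain ⟨hm2, hm3⟩ := hm3
  have hm0 : m ≠ 0 := by
    rintro rfl
    norm_num at hm3
  obtain ⟨v, hv⟩ := exists_mem_iff_degree_dvd.2 hmd
  have hinv : ∀ a, zeta * a ∈ fib S ↔ a ∈ fib S := by
    intro a
    have := zpow_degree_mem_fib_iff hv a
    dsimp only at this
    rwa [zetaMul_zpow_apply, zetaUnit_zpow_emod, hm3, zpow_one] at this
  obtain ⟨α, hα⟩ := exists_eq_multiples hinv
  have hα0 : α ≠ 0 := by
    rintro rfl
    rw [hα, index_multiples, QuadraticAlgebra.norm_zero] at hm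
    exact hm rfl
  have hcm : (cubeRoot : ℂ) ^ m = cubeRoot := by
    rw [cubeRoot_zpow_emod, hm3, zpow_one]
  have hα0' := toComplex_ne_zero hα0
  have hm0' : (m : ℝ) ≠ 0 := Int.cast_ne_zero.2 hm0
  have hc : (1 - cubeRoot : ℂ) ≠ 0 := sub_ne_zero.2 cubeRoot_ne_one.symm
  -- The fixed point of `u ↦ ζ u + v`, the `ℂ`-part of the screw motion `(v, m)`.
  set w : ℂ := toComplex v / (1 - cubeRoot) with hw
  have hwv : (cubeRoot : ℂ) * w + toComplex v = w := by
    rw [hw]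
    field_simp
    ring
  let F : (ℂ × ℝ) ≃ₜ (ℂ × ℝ) :=
    ((Homeomorph.mulLeft₀ _ hα0').trans (Homeomorph.addRight w)).prodCongr
      (Homeomorph.mulLeft₀ _ hm0')
  have hF : ∀ e, F e = (toComplex α * e.1 + w, (m : ℝ) * e.2) := fun _ => rfl
  let y : TricosmModel := ⟨v, m⟩
  let z : TricosmModel := ⟨0, 1⟩
  have hz : ∀ e, F (z • e) = y • F e := by
    intro e
    rw [hF, hF, smul_def, smul_def]
    ext1
    · simp only [z, y, zpow_one, map_zero, hcm]
      linear_combination -hwv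
    · simp only [z, y]
      push_cast
      ring
  have hzj : ∀ (j : ℤ) e, F (z ^ j • e) = y ^ j • F e := by
    intro j
    induction j with
    | zero => simp
    | succ i ih => intro e; rw [zpow_add_one, zpow_add_one, mul_smul, mul_smul, ih, hz]
    | pred i ih =>
      intro e
      have h := hz (z⁻¹ • e)
      rw [smul_inv_smul] at h
      rw [zpow_sub_one, zpow_sub_one, mul_smul, mul_smul, ih, h, inv_smul_smul]
  have hzj' : ∀ x : TricosmModel, x = ⟨x.base, 0⟩ * z ^ x.deg := by
    intro x
    have h0 : ∀ j : ℤ, (z ^ j).base = 0 := by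
      intro j
      have h1 : fib (Subgroup.zpowers z) = ⊥ := by
        rw [eq_bot_iff]
        intro a ha
        obtain ⟨i, hi⟩ := Subgroup.mem_zpowers_iff.1 (mem_fib.1 ha)
        have h2 := congrArg TwistedProduct.deg hi
        rw [zpow_deg] at h2
        have h3 : i = 0 := by simpa [z] using h2
        rw [h3, zpow_zero] at hi
        exact (congrArg TwistedProduct.base hi).symm
      induction j with
      | zero => rfl
      | succ i ih => rw [zpow_add_one, mul_base, ih]; simp [z]
      | pred i ih => rw [zpow_sub_one, mul_base, ih]; simp [z]
    ext1
    · simp [h0]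
    · simp [z]
  let ψ : TricosmModel → TricosmModel := fun x => ⟨α * x.base, 0⟩ * y ^ x.deg
  have hψ : ∀ x e, F (x • e) = ψ x • F e := by
    intro x e
    conv_lhs => rw [hzj' x]
    rw [mul_smul, mul_smul, ← hzj]
    generalize z ^ x.deg • e = e'
    rw [hF, hF, smul_def, smul_def]
    ext1
    · simp only [zpow_zero, map_mul]
      ring
    · simp
  have hp := isQuotientCoveringMap_tricosm
  have hψS : ∀ x, ψ x ∈ S := by
    intro x
    refine S.mul_mem ?_ (S.zpow_mem hv _)
    rw [← mem_fib, hα, mem_multiples]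
    exact dvd_mul_right _ _
  have hψsurj : ∀ s ∈ S, ∃ x, ψ x = s := by
    intro s hs
    obtain ⟨j, hj⟩ := hm2.trans (degree_dvd_of_mem hs)
    have h1 : s * (y ^ j)⁻¹ ∈ S := S.mul_mem hs (S.inv_mem (S.zpow_mem hv j))
    have h2 : s * (y ^ j)⁻¹ = ⟨(s * (y ^ j)⁻¹).base, 0⟩ := by
      ext1
      · rfl
      · rw [mul_deg, inv_deg, zpow_deg, hj]
        exact add_neg_cancel _
    rw [h2, ← mem_fib, hα, mem_multiples] at h1
    obtain ⟨b, hb⟩ := h1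
    refine ⟨⟨b, j⟩, ?_⟩
    change (⟨α * b, 0⟩ : TricosmModel) * y ^ j = s
    rw [← hb, ← h2, inv_mul_cancel_right]
  constructor
  -- Multiplicativity of `ψ` follows from freeness: both products act in the same way on the point
  -- `F 0`.
  · let f : TricosmModel →* S :=
      MonoidHom.mk' (fun x => ⟨ψ x, hψS x⟩) fun a b => by
        refine Subtype.ext (hp.eq_of_smul_eq (e := F 0) ?_)
        change ψ (a * b) • F 0 = (ψ a * ψ b) • F 0
        rw [← hψ, mul_smul a b, hψ, hψ, mul_smul (ψ a) (ψ b)]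
    refine ⟨(MulEquiv.ofBijective f ⟨fun a b hab => ?_, ?_⟩).symm⟩
    · have h1 : ψ a = ψ b := Subtype.ext_iff.1 hab
      refine hp.eq_of_smul_eq (e := (0 : ℂ × ℝ)) (F.injective ?_)
      rw [hψ, hψ, h1]
    · rintro ⟨s, hs⟩
      obtain ⟨x, hx⟩ := hψsurj s hs
      exact ⟨x, Subtype.ext hx⟩
  · obtain ⟨h, -⟩ := exists_homeomorph_of_isQuotientMap
      ((hp.mk_subgroup S).toIsQuotientMap.comp F.isQuotientMap) hp.toIsQuotientMap
      (fun a b => by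
        rw [hp.apply_eq_iff_mem_orbit, MulAction.mem_orbit_iff, Function.comp_apply,
          Function.comp_apply, IsQuotientCoveringMap.mk_eq_mk_iff]
        constructor
        · rintro ⟨s, hs, h⟩
          obtain ⟨x, rfl⟩ := hψsurj s hs
          exact ⟨x, F.injective (by rw [hψ, h])⟩
        · rintro ⟨x, rfl⟩
          exact ⟨ψ x, hψS x, (hψ x b).symm⟩)
    exact ⟨h⟩

theorem not_comm : ¬ ∀ x y : TricosmModel, x * y = y * x := by
  intro h
  have h1 := congrArg TwistedProduct.base (h ⟨1, 0⟩ ⟨0, 1⟩)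
  simp only [mul_base, zpow_zero, map_zero, zpow_one, zetaMul_apply, mul_one, add_zero,
    zero_add] at h1
  exact absurd h1 (by decide)

theorem comm_of_mulEquiv {G H : Type*} [Group G] [Group H] (e : G ≃* H)
    (h : ∀ x y : H, x * y = y * x) (x y : G) : x * y = y * x := by
  apply e.injective
  rw [map_mul, map_mul, h]

theorem nonempty_mulEquiv_int_iff (hS : S.index ≠ 0) :
    Nonempty (S ≃* Multiplicative (Fin 3 → ℤ)) ↔ 3 ∣ degree S := by
  refine ⟨fun ⟨e⟩ => ?_, fun h => (of_three_dvd_degree h hS).1⟩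
  by_contra h3
  obtain ⟨⟨f⟩, -⟩ := of_not_three_dvd_degree h3 hS
  exact not_comm (comm_of_mulEquiv (f.symm.trans e) fun x y => mul_comm x y)

theorem nonempty_mulEquiv_self_iff (hS : S.index ≠ 0) :
    Nonempty (S ≃* TricosmModel) ↔ ¬ 3 ∣ degree S := by
  refine ⟨fun ⟨e⟩ h3 => ?_, fun h => (of_not_three_dvd_degree h hS).1⟩
  obtain ⟨⟨f⟩, -⟩ := of_three_dvd_degree h3 hS
  exact not_comm (comm_of_mulEquiv (e.symm.trans f) fun x y => mul_comm x y)

/-- The fundamental group of an orbit space of Euclidean space. -/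
theorem nonempty_fundamentalGroup_mulEquiv_of_homeomorph {X : Type*} [TopologicalSpace X]
    (h : Quotient (MulAction.orbitRel S (ℂ × ℝ)) ≃ₜ X) (x : X) :
    Nonempty (FundamentalGroup X x ≃* S) := by
  have hq := (isQuotientCoveringMap_tricosm.mk_subgroup S).homeomorph_comp h
  obtain ⟨e, he⟩ := hq.surjective x
  exact ⟨(hq.fundamentalGroupEquiv ⟨e, he⟩).trans (MulEquiv.inv' _).symm⟩

theorem nonempty_homeomorph_tricosm_iff (hS : S.index ≠ 0) :
    Nonempty (Quotient (MulAction.orbitRel S (ℂ × ℝ)) ≃ₜ Tricosm) ↔ ¬ 3 ∣ degree S := by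
  rw [← nonempty_mulEquiv_self_iff hS]
  constructor
  · rintro ⟨h⟩
    obtain ⟨e⟩ := nonempty_fundamentalGroup_mulEquiv_of_homeomorph h (Quotient.mk _ 0)
    obtain ⟨f⟩ := nonempty_fundamentalGroup_mulEquiv (Quotient.mk _ 0)
    exact ⟨e.symm.trans f⟩
  · intro h
    exact (of_not_three_dvd_degree ((nonempty_mulEquiv_self_iff hS).1 h) hS).2

/-- There is a subgroup of finite index consisting of translations. -/
theorem exists_three_dvd_degree :
    ∃ T : Subgroup TricosmModel, T.index ≠ 0 ∧ 3 ∣ degree T := by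
  refine ⟨ofData (3 : ℕ) ⊤ (by simp) 0, ?_, ?_⟩
  · rw [index_ofData _ _ (by norm_num)]
    simp
  · rw [degree_ofData]

/-- The fundamental group of the torus is read off from the model itself: some translation subgroup
`T` of finite index is isomorphic to `ℤ³` and has the torus as orbit space. Hence any `S` with toral
orbit space is isomorphic to `ℤ³`. -/
theorem nonempty_homeomorph_torus_iff (hS : S.index ≠ 0) :
    Nonempty (Quotient (MulAction.orbitRel S (ℂ × ℝ)) ≃ₜ Torus3) ↔ 3 ∣ degree S := by
  refine ⟨fun ⟨h⟩ => ?_, fun h => (of_three_dvd_degree h hS).2⟩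
  rw [← nonempty_mulEquiv_int_iff hS]
  obtain ⟨T, hT, hT3⟩ := exists_three_dvd_degree
  obtain ⟨⟨f⟩, ⟨k⟩⟩ := of_three_dvd_degree hT3 hT
  obtain ⟨e⟩ := nonempty_fundamentalGroup_mulEquiv_of_homeomorph h 0
  obtain ⟨e'⟩ := nonempty_fundamentalGroup_mulEquiv_of_homeomorph k 0
  exact ⟨(e.symm.trans e').trans f⟩

end TricosmModel

open EisensteinInt TwistedProduct

/-! ### Arithmetic -/

/-- Writing `d = 3 e` turns `n / d` into `(n / 3) / e`, and `e ↦ (n / 3) / e` permutes the divisors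
of `n / 3`. -/
theorem sum_divisors_filter_three_dvd (n : ℕ) (g : ℕ → ℕ) :
    ∑ d ∈ n.divisors with 3 ∣ d, g (n / d) = atQuot (fun m => ∑ k ∈ m.divisors, g k) n 3 := by
  rw [atQuot]
  split_ifs with h
  · obtain ⟨m, rfl⟩ := h
    rw [Nat.mul_div_cancel_left m (by norm_num)]
    rcases Nat.eq_zero_or_pos m with rfl | hm
    · simp
    rw [← Nat.sum_div_divisors]
    symm
    refine Finset.sum_bij (fun d _ => 3 * d) ?_ ?_ ?_ ?_
    · intro d hd
      have := Nat.dvd_of_mem_divisors hd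
      exact Finset.mem_filter.2 ⟨Nat.mem_divisors.2 ⟨Nat.mul_dvd_mul_left 3 this, by omega⟩,
        dvd_mul_right _ _⟩
    · intro a _ b _ hab
      exact Nat.eq_of_mul_eq_mul_left (by norm_num) hab
    · intro d hd
      obtain ⟨hd, k, rfl⟩ := Finset.mem_filter.1 hd
      refine ⟨k, Nat.mem_divisors.2 ⟨?_, hm.ne'⟩, rfl⟩
      exact Nat.dvd_of_mul_dvd_mul_left (by norm_num) (Nat.dvd_of_mem_divisors hd)
    · intro d _
      rw [Nat.mul_div_mul_left _ _ (by norm_num)]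
  · refine Finset.sum_eq_zero fun d hd => ?_
    obtain ⟨hd, h3⟩ := Finset.mem_filter.1 hd
    exact absurd (h3.trans (Nat.dvd_of_mem_divisors hd)) h

/-- The number of pairs of an ideal `I` of norm `m` and an element of `ℤ[ζ] / (I + (1 - ζ))`. -/
noncomputable def cosetCount (m : ℕ) : ℕ := theta m * if 3 ∣ m then 3 else 1

/-- The excess of `cosetCount k` over `θ(k)` is `2 θ(k)`, present only for `3 ∣ k`; there `θ(k) =
θ(k / 3)`. -/
theorem sum_cosetCount (n : ℕ) :
    ∑ k ∈ n.divisors, cosetCount k = sumTheta n + 2 * atQuot sumTheta n 3 := by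
  have h1 : ∀ k, cosetCount k = theta k + 2 * if 3 ∣ k then theta k else 0 := by
    intro k
    rw [cosetCount]
    split_ifs <;> ring
  simp_rw [h1]
  rw [Finset.sum_add_distrib, ← Finset.mul_sum, ← Finset.sum_filter]
  congr 2
  rw [atQuot]
  split_ifs with h
  · obtain ⟨m, rfl⟩ := h
    rw [Nat.mul_div_cancel_left m (by norm_num)]
    rcases Nat.eq_zero_or_pos m with rfl | hm
    · simp [sumTheta]
    symm
    refine Finset.sum_bij (fun d _ => 3 * d) ?_ ?_ ?_ ?_
    · intro d hd
      have := Nat.dvd_of_mem_divisors hd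
      exact Finset.mem_filter.2 ⟨Nat.mem_divisors.2 ⟨Nat.mul_dvd_mul_left 3 this, by omega⟩,
        dvd_mul_right _ _⟩
    · intro a _ b _ hab
      exact Nat.eq_of_mul_eq_mul_left (by norm_num) hab
    · intro d hd
      obtain ⟨hd, k, rfl⟩ := Finset.mem_filter.1 hd
      refine ⟨k, Nat.mem_divisors.2 ⟨?_, hm.ne'⟩, rfl⟩
      exact Nat.dvd_of_mul_dvd_mul_left (by norm_num) (Nat.dvd_of_mem_divisors hd)
    · intro d hd
      exact (theta_three_mul (Nat.pos_of_mem_divisors hd)).symm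
  · refine Finset.sum_eq_zero fun d hd => ?_
    obtain ⟨hd, h3⟩ := Finset.mem_filter.1 hd
    exact absurd (h3.trans (Nat.dvd_of_mem_divisors hd)) h

theorem sum_cosetCount_three_dvd (n : ℕ) :
    ∑ d ∈ n.divisors with 3 ∣ d, cosetCount (n / d) =
      atQuot sumTheta n 3 + 2 * atQuot sumTheta n 9 := by
  rw [sum_divisors_filter_three_dvd]
  simp only [atQuot, sum_cosetCount]
  split_ifs with h3 h33 h9 h9 h9
  · rw [Nat.div_div_eq_div_mul]
  · omega
  · omega
  · rfl
  · omega
  · rfl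

/-- The sum over all divisors minus the part with `3 ∣ d`. The `n / 9` term stands on the left to
avoid truncated subtraction. -/
theorem sum_cosetCount_not_three_dvd (n : ℕ) :
    (∑ d ∈ n.divisors with ¬ 3 ∣ d, cosetCount (n / d)) + 2 * atQuot sumTheta n 9 =
      sumTheta n + atQuot sumTheta n 3 := by
  have h1 := Finset.sum_filter_add_sum_filter_not n.divisors (3 ∣ ·)
    (fun d => cosetCount (n / d))
  rw [sum_cosetCount_three_dvd, Nat.sum_div_divisors, sum_cosetCount] at h1
  omega

/-! ### Sublattices of the Eisenstein integers -/

theorem finite_and_card_addSubgroup_int {m : ℕ} :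
    Finite {L : AddSubgroup ℤ // L.index = m} ∧
      Nat.card {L : AddSubgroup ℤ // L.index = m} = 1 := by
  have h : Unique {L : AddSubgroup ℤ // L.index = m} :=
    { default := ⟨AddSubgroup.zmultiples (m : ℤ), by rw [Int.index_zmultiples, Int.natAbs_natCast]⟩
      uniq := fun L => Subtype.ext (by
        rw [Int.addSubgroup_eq_zmultiples_index L.1, L.2]) }
  exact ⟨inferInstance, Nat.card_unique⟩

/-- Additively the ring is `ℤ ⋊ ℤ` with trivial action, so the same count of subgroups applies:
degree `d` leaves one sublattice of `ℤ` and `m / d` cosets. -/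
theorem finite_and_card_addSubgroup_eisensteinInt {m : ℕ} (hm : 0 < m) :
    Finite {L : AddSubgroup EisensteinInt // L.index = m} ∧
      Nat.card {L : AddSubgroup EisensteinInt // L.index = m} = sigmaOne m := by
  let φ : ℤ ≃ₗ[ℤ] ℤ := 1
  have hφ : ∀ k : ℤ, φ ^ k = 1 := one_zpow
  have hfin : ∀ k, Finite {L : AddSubgroup ℤ // L.index = k} := fun k =>
    (finite_and_card_addSubgroup_int (m := k)).1
  have hpos : ∀ d ∈ m.divisors, 0 < m / d := fun d hd =>
    Nat.div_pos (Nat.divisor_le hd) (Nat.pos_of_mem_divisors hd)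
  have h1 := finite_and_card_subgroups (φ := φ) hm (fun _ => True) (fun _ => True)
    (c := fun d => m / d)
    (fun d hd _ => (finite_and_card_of_trivial (Nat.pos_of_mem_divisors hd) (hpos d hd)
      (fun a => by rw [hφ]; rfl)).1)
    (fun d hd _ => by
      rw [(finite_and_card_of_trivial (Nat.pos_of_mem_divisors hd) (hpos d hd)
        (fun a => by rw [hφ]; rfl)).2, finite_and_card_addSubgroup_int.2, one_mul])
  let e : Multiplicative EisensteinInt ≃* TwistedProduct φ :=
    { toFun := fun a => ⟨a.toAdd.re, a.toAdd.im⟩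
      invFun := fun x => Multiplicative.ofAdd ⟨x.base, x.deg⟩
      left_inv := fun a => rfl
      right_inv := fun x => rfl
      map_mul' := fun a b => by
        ext1
        · rw [mul_base, hφ]
          rfl
        · rfl }
  let E : {L : AddSubgroup EisensteinInt // L.index = m} ≃
      {S : Subgroup (TwistedProduct φ) // S.index = m ∧ True ∧ True} :=
    (AddSubgroup.toSubgroup.toEquiv.trans e.mapSubgroup.toEquiv).subtypeEquiv fun L => by
      rw [and_true, and_true]
      have : (e.mapSubgroup (AddSubgroup.toSubgroup L)).index = L.index :=
        (Subgroup.index_map_equiv (AddSubgroup.toSubgroup L) e).trans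
          (AddSubgroup.index_toSubgroup L)
      exact ⟨fun h => this.trans h, fun h => this.symm.trans h⟩
  have := h1.1
  refine ⟨Finite.of_equiv _ E.symm, ?_⟩
  rw [Nat.card_congr E, h1.2]
  simp only [Finset.filter_true]
  exact Nat.sum_div_divisors m id

namespace TricosmModel

/-! ### Subgroups consisting of translations -/

/-- For `3 ∣ d` the action of `ζ ^ d` is trivial: all `σ₁(n / d)` sublattices are admissible, each
with `n / d` cosets. -/
theorem finite_and_card_three_dvd_degree {n : ℕ} (hn : 0 < n) :
    Finite {S : Subgroup TricosmModel // S.index = n ∧ 3 ∣ degree S ∧ True} ∧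
      Nat.card {S : Subgroup TricosmModel // S.index = n ∧ 3 ∣ degree S ∧ True} =
        atQuot omegaFun n 3 := by
  have hpos : ∀ d ∈ n.divisors, 0 < n / d := fun d hd =>
    Nat.div_pos (Nat.divisor_le hd) (Nat.pos_of_mem_divisors hd)
  have key : ∀ d ∈ n.divisors, 3 ∣ d → Finite {S : Subgroup TricosmModel //
      (degree S = d ∧ (fib S).index = n / d) ∧ True} ∧ Nat.card {S : Subgroup TricosmModel //
      (degree S = d ∧ (fib S).index = n / d) ∧ True} = n / d * sigmaOne (n / d) := by
    intro d hd h3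
    obtain ⟨hf, hc⟩ := finite_and_card_addSubgroup_eisensteinInt (hpos d hd)
    have := finite_and_card_of_trivial (φ := zetaMul) (Nat.pos_of_mem_divisors hd) (hpos d hd)
      (zetaMul_zpow_of_dvd (Int.natCast_dvd_natCast.2 h3))
    rw [hc, mul_comm] at this
    exact this
  have h1 := finite_and_card_subgroups (φ := zetaMul) hn (3 ∣ ·) (fun _ => True)
    (c := fun d => n / d * sigmaOne (n / d)) (fun d hd h3 => (key d hd h3).1)
    (fun d hd h3 => (key d hd h3).2)
  refine ⟨h1.1, h1.2.trans ?_⟩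
  exact sum_divisors_filter_three_dvd n fun k => k * sigmaOne k

/-- The screw motion `(0, 1)`. -/
def screw : TricosmModel := ⟨0, 1⟩

theorem zpow_mem_iff_of_invariant {L : AddSubgroup EisensteinInt}
    (hL : ∀ a, zeta * a ∈ L ↔ a ∈ L) (k : ℤ) (a : EisensteinInt) :
    (zetaMul ^ k) a ∈ L ↔ a ∈ L := by
  have := LinearEquiv.zpow_mul_mem_iff (φ := zetaMul) (d := 1) (L := L)
    (fun a => by rw [zpow_one]; exact hL a) k a
  rwa [one_mul] at this

/-- Conjugation by the screw motion keeps a `ζ`-stable `L` and replaces `u` by `ζ u`. -/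
theorem map_conj_screw_eq_iff {d : ℕ} (hd : 0 < d) {L : AddSubgroup EisensteinInt}
    (hL : ∀ a, zeta * a ∈ L ↔ a ∈ L) (hL' : ∀ a, (zetaMul ^ (d : ℤ)) a ∈ L ↔ a ∈ L)
    (u : EisensteinInt) :
    (ofData (d : ℤ) L hL' u).map (MulAut.conj screw).toMonoidHom = ofData (d : ℤ) L hL' u ↔
      (1 - zeta) * u ∈ L := by
  have hdeg := (degree_map_conj (S := ofData (d : ℤ) L hL' u) screw).trans (degree_ofData hL' u)
  rw [eq_comm, ofData_eq_iff hL' u hd hdeg]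
  have hfib : fib ((ofData (d : ℤ) L hL' u).map (MulAut.conj screw).toMonoidHom) = L := by
    ext a
    obtain ⟨b, rfl⟩ := (zetaMul ^ screw.deg).surjective a
    rw [zpow_mem_fib_map_conj, fib_ofData hL' u hd, zpow_mem_iff_of_invariant hL]
  have h1 := mk_mem_map_conj screw (mk_mem_ofData hL' u)
  rw [sub_mem_fib h1, hfib, and_iff_right rfl]
  have : u - (screw.base + (zetaMul ^ screw.deg) u - (zetaMul ^ (d : ℤ)) screw.base) =
      (1 - zeta) * u := by
    simp only [screw, map_zero, zpow_one, zetaMul_apply]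
    ring
  rw [this]

end TricosmModel

/-- An endomorphism of a finite abelian group has kernel and cokernel of the same size. -/
theorem AddMonoidHom.card_ker_eq_index_range {Q : Type*} [AddCommGroup Q] [Finite Q]
    (f : Q →+ Q) : Nat.card f.ker = f.range.index := by
  have h1 := f.ker.card_mul_index
  have h2 := f.range.card_mul_index
  rw [AddSubgroup.index_ker] at h1
  have h3 : 0 < Nat.card f.range := Nat.card_pos
  rw [← h2, mul_comm] at h1
  exact Nat.eq_of_mul_eq_mul_left h3 h1

namespace EisensteinInt

/-- This is the kernel of multiplication by `1 - ζ` on `ℤ[ζ] / L`, which has the size of the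
cokernel `ℤ[ζ] / (L + (1 - ζ))`. -/
theorem card_quotient_killed {m : ℕ} (hm : 0 < m) (L : InvariantSubgroup m) :
    Nat.card {c : EisensteinInt ⧸ L.1 // (1 - zeta) * c.out ∈ L.1} = if 3 ∣ m then 3 else 1 := by
  rw [← index_sup_multiples L]
  have hfin : Finite (EisensteinInt ⧸ L.1) :=
    Nat.finite_of_card_ne_zero (by change L.1.index ≠ 0; rw [L.2.1]; exact hm.ne')
  have hmul : ∀ a ∈ L.1, (1 - zeta) * a ∈ L.1 := fun a ha => by
    rw [sub_mul, one_mul]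
    exact L.1.sub_mem ha ((L.2.2 a).2 ha)
  let f : EisensteinInt ⧸ L.1 →+ EisensteinInt ⧸ L.1 :=
    QuotientAddGroup.map L.1 L.1 (AddMonoidHom.mulLeft (1 - zeta)) hmul
  have hf : ∀ a : EisensteinInt, f (QuotientAddGroup.mk a) =
    QuotientAddGroup.mk ((1 - zeta) * a) := fun _ => rfl
  have h1 : Nat.card {c : EisensteinInt ⧸ L.1 // (1 - zeta) * c.out ∈ L.1} = Nat.card f.ker := by
    refine Nat.card_congr (Equiv.subtypeEquivRight fun c => ?_)
    rw [AddMonoidHom.mem_ker]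
    conv_rhs => rw [← QuotientAddGroup.out_eq' c]
    rw [hf, QuotientAddGroup.eq_zero_iff]
  rw [h1, f.card_ker_eq_index_range,
    ← AddSubgroup.index_comap_of_surjective f.range (QuotientAddGroup.mk'_surjective L.1)]
  congr 1
  ext a
  rw [AddSubgroup.mem_comap, AddSubgroup.mem_sup]
  constructor
  · rintro ⟨c, hc⟩
    obtain ⟨b, rfl⟩ := QuotientAddGroup.mk_surjective c
    rw [hf, QuotientAddGroup.mk'_apply, eq_comm, QuotientAddGroup.eq] at hc
    refine ⟨_, L.1.neg_mem hc, (1 - zeta) * b, mem_multiples.2 (dvd_mul_right _ _), ?_⟩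
    abel
  · rintro ⟨l, hl, _, hb, rfl⟩
    obtain ⟨b, rfl⟩ := mem_multiples.1 hb
    refine ⟨QuotientAddGroup.mk b, ?_⟩
    rw [hf, QuotientAddGroup.mk'_apply, QuotientAddGroup.eq]
    convert hl using 1
    abel

end EisensteinInt

namespace TricosmModel

/-- A subgroup fixed by the screw motion has a `ζ`-stable intersection with `ℤ[ζ]`, hence an ideal,
together with a coset killed by `1 - ζ`: `cosetCount (n / d)` possibilities in degree `d`. -/
theorem finite_and_card_fixed {n : ℕ} (hn : 0 < n) :
    Finite {S : Subgroup TricosmModel // S.index = n ∧ 3 ∣ degree S ∧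
        S.map (MulAut.conj screw).toMonoidHom = S} ∧
      Nat.card {S : Subgroup TricosmModel // S.index = n ∧ 3 ∣ degree S ∧
        S.map (MulAut.conj screw).toMonoidHom = S} =
        atQuot sumTheta n 3 + 2 * atQuot sumTheta n 9 := by
  have key : ∀ d ∈ n.divisors, 3 ∣ d → Finite {S : Subgroup TricosmModel //
      (degree S = d ∧ (fib S).index = n / d) ∧ S.map (MulAut.conj screw).toMonoidHom = S} ∧
      Nat.card {S : Subgroup TricosmModel // (degree S = d ∧ (fib S).index = n / d) ∧
        S.map (MulAut.conj screw).toMonoidHom = S} = cosetCount (n / d) := by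
    intro d hd h3
    have hd0 := Nat.pos_of_mem_divisors hd
    have hm : 0 < n / d := Nat.div_pos (Nat.divisor_le hd) hd0
    obtain ⟨e⟩ := nonempty_equiv_sigma (φ := zetaMul) (m := n / d) hd0
      (fun S => S.map (MulAut.conj screw).toMonoidHom = S)
      (fun L => ∀ a, zeta * a ∈ L ↔ a ∈ L) (fun L hL => zpow_mem_iff_of_invariant hL d)
      (fun S _ hS a => by
        have := zpow_mem_fib_map_conj (S := S) screw (a := a)
        rw [hS] at this
        exact this)
    have := finite_invariantSubgroup hm
    have : Fintype (InvariantSubgroup (n / d)) := Fintype.ofFinite _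
    have hcard : ∀ L : InvariantSubgroup (n / d), Nat.card {c : EisensteinInt ⧸ L.1 //
        (ofData (d : ℤ) L.1 (zpow_mem_iff_of_invariant L.2.2 d) c.out).map
          (MulAut.conj screw).toMonoidHom =
            ofData (d : ℤ) L.1 (zpow_mem_iff_of_invariant L.2.2 d) c.out} =
        if 3 ∣ n / d then 3 else 1 := by
      intro L
      rw [← card_quotient_killed hm L]
      exact Nat.card_congr (Equiv.subtypeEquivRight fun c =>
        map_conj_screw_eq_iff hd0 L.2.2 _ _)
    have hfin : ∀ L : InvariantSubgroup (n / d), Finite {c : EisensteinInt ⧸ L.1 //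
        (ofData (d : ℤ) L.1 (zpow_mem_iff_of_invariant L.2.2 d) c.out).map
          (MulAut.conj screw).toMonoidHom =
            ofData (d : ℤ) L.1 (zpow_mem_iff_of_invariant L.2.2 d) c.out} := by
      intro L
      refine Nat.finite_of_card_ne_zero ?_
      rw [hcard]
      split_ifs <;> norm_num
    refine ⟨Finite.of_equiv _ e.symm, ?_⟩
    rw [Nat.card_congr e, Nat.card_sigma, Finset.sum_congr rfl fun L _ => hcard L,
      Finset.sum_const, smul_eq_mul, cosetCount, ← card_invariantSubgroup hm,
      Nat.card_eq_fintype_card]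
    rfl
  have h1 := finite_and_card_subgroups (φ := zetaMul) hn (3 ∣ ·)
    (fun S => S.map (MulAut.conj screw).toMonoidHom = S)
    (c := fun d => cosetCount (n / d)) (fun d hd h3 => (key d hd h3).1)
    (fun d hd h3 => (key d hd h3).2)
  exact ⟨h1.1, h1.2.trans (sum_cosetCount_three_dvd n)⟩

end TricosmModel

open EisensteinInt TwistedProduct

/-- Burnside's lemma for a permutation of order dividing three. -/
theorem card_orbits_of_pow_three_eq_one {X : Type*} [Finite X] (f : Equiv.Perm X)
    (hf : f ^ 3 = 1) (r : Setoid X) (hr : ∀ x y, r x y ↔ ∃ j : ℤ, (f ^ j) x = y) :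
    Nat.card (Quotient r) * 3 = Nat.card X + 2 * Nat.card {x // f x = x} := by
  classical
  have := Fintype.ofFinite X
  let F : ℤ →+ Additive (Equiv.Perm X) := zmultiplesHom _ (Additive.ofMul f)
  have hF : F 3 = 0 := by
    change (3 : ℤ) • Additive.ofMul f = 0
    rw [← ofMul_zpow]
    exact congrArg Additive.ofMul hf
  let ρ : Multiplicative (ZMod 3) →* Equiv.Perm X :=
    AddMonoidHom.toMultiplicativeLeft (ZMod.lift 3 ⟨F, hF⟩)
  have hρ : ∀ j : ℤ, ρ (Multiplicative.ofAdd (j : ZMod 3)) = f ^ j :=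
    fun j => congrArg Additive.toMul (ZMod.lift_coe 3 ⟨F, hF⟩ j)
  let _ : MulAction (Multiplicative (ZMod 3)) X := MulAction.compHom X ρ
  have hsmul : ∀ (j : ℤ) (x : X), Multiplicative.ofAdd (j : ZMod 3) • x = (f ^ j) x := by
    intro j x
    rw [← hρ]
    rfl
  have hrel : MulAction.orbitRel (Multiplicative (ZMod 3)) X = r := by
    ext x y
    rw [r.comm', hr, MulAction.orbitRel_apply, MulAction.mem_orbit_iff]
    constructor
    · rintro ⟨k, hk⟩
      obtain ⟨j, hj⟩ := ZMod.intCast_surjective k.toAdd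
      refine ⟨j, ?_⟩
      rw [← hsmul, hj]
      exact hk
    · rintro ⟨j, hj⟩
      exact ⟨_, (hsmul j y).trans hj⟩
  have hfix : ∀ j : ℤ, (∀ x, (f ^ j) x = x ↔ f x = x) →
      Fintype.card (MulAction.fixedBy X (Multiplicative.ofAdd (j : ZMod 3))) =
        Nat.card {x // f x = x} := by
    intro j hj
    rw [← Nat.card_eq_fintype_card]
    refine Nat.card_congr (Equiv.subtypeEquivRight fun x => ?_)
    rw [MulAction.mem_fixedBy, hsmul, hj]
  have h0 : Fintype.card (MulAction.fixedBy X (Multiplicative.ofAdd (0 : ZMod 3))) =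
      Nat.card X := by
    rw [← Nat.card_eq_fintype_card]
    refine Nat.card_congr (Equiv.subtypeUnivEquiv fun x => ?_)
    exact one_smul (Multiplicative (ZMod 3)) x
  have h1 := hfix 1 fun x => by rw [zpow_one]
  -- Since `f ^ 3 = 1`, the permutations `f` and `f ^ 2` have the same fixed points, whence the
  -- coefficient 2.
  have h2 := hfix 2 fun x => by
    have h3 : f (f (f x)) = x := by
      have := congrArg (fun g : Equiv.Perm X => g x) hf
      simpa [pow_succ] using this
    have hx : (f ^ (2 : ℤ)) x = f (f x) := rfl
    rw [hx]
    constructor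
    · intro h
      rw [h] at h3
      exact h3
    · intro h
      rw [h, h]
  have hB := MulAction.sum_card_fixedBy_eq_card_orbits_mul_card_group
    (Multiplicative (ZMod 3)) X
  rw [← Equiv.sum_comp Multiplicative.ofAdd, ← Nat.card_eq_fintype_card, hrel] at hB
  have h4 : Fintype.card (Multiplicative (ZMod 3)) = 3 := rfl
  rw [h4] at hB
  rw [← hB]
  have hsum : ∀ g : ZMod 3 → ℕ, ∑ i, g i = g 0 + g ((1 : ℤ) : ZMod 3) + g ((2 : ℤ) : ZMod 3) :=
    fun g => Fin.sum_univ_three g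
  rw [hsum, h0, h1, h2]
  ring

namespace TricosmModel

/-! ### Conjugacy classes of subgroups consisting of translations -/

theorem map_conj_mul {G : Type*} [Group G] (S : Subgroup G) (g h : G) :
    S.map (MulAut.conj (g * h)).toMonoidHom =
      (S.map (MulAut.conj h).toMonoidHom).map (MulAut.conj g).toMonoidHom := by
  rw [Subgroup.map_map]
  congr 1
  ext x
  simp

theorem map_conj_one {G : Type*} [Group G] (S : Subgroup G) :
    S.map (MulAut.conj (1 : G)).toMonoidHom = S := by
  ext x
  simp

theorem index_map_conj {G : Type*} [Group G] (S : Subgroup G) (g : G) :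
    (S.map (MulAut.conj g).toMonoidHom).index = S.index :=
  Subgroup.index_map_equiv S (MulAut.conj g)

/-- The coboundary term of `conj_eq` cancels because `ζ ^ x.deg = 1`, so only the degree of `g`
matters and conjugacy classes become orbits of the screw motion. -/
theorem conj_of_dvd (g : TricosmModel) {x : TricosmModel} (hx : 3 ∣ x.deg) :
    g * x * g⁻¹ = screw ^ g.deg * x * (screw ^ g.deg)⁻¹ := by
  rw [conj_eq, conj_eq, zetaMul_zpow_of_dvd hx, zetaMul_zpow_of_dvd hx, zpow_deg]
  ext1
  · simp [screw]
  · rfl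

theorem map_conj_of_three_dvd {S : Subgroup TricosmModel} (h3 : 3 ∣ degree S)
    (g : TricosmModel) : S.map (MulAut.conj g).toMonoidHom =
      S.map (MulAut.conj (screw ^ g.deg)).toMonoidHom := by
  ext y
  rw [Subgroup.mem_map, Subgroup.mem_map]
  refine exists_congr fun x => and_congr_right fun hx => ?_
  simp only [MulEquiv.coe_toMonoidHom, MulAut.conj_apply]
  rw [conj_of_dvd g (dvd_deg_of_mem h3 hx)]

/-- Burnside's lemma for conjugation by the screw motion, whose cube `(0, 3)` is central. -/
theorem finite_and_ncard_conjClasses_three_dvd {n : ℕ} (hn : 0 < n) :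
    {O | ∃ S : Subgroup TricosmModel, S.index = n ∧ 3 ∣ degree S ∧
        O = subgroupConjClass S}.Finite ∧
      {O | ∃ S : Subgroup TricosmModel, S.index = n ∧ 3 ∣ degree S ∧
        O = subgroupConjClass S}.ncard * 3 = atQuot omegaFun n 3 +
          2 * (atQuot sumTheta n 3 + 2 * atQuot sumTheta n 9) := by
  obtain ⟨hfin, hcard⟩ := finite_and_card_three_dvd_degree hn
  set X := {S : Subgroup TricosmModel // S.index = n ∧ 3 ∣ degree S ∧ True}
  let c : TricosmModel → X → X := fun g S => ⟨S.1.map (MulAut.conj g).toMonoidHom,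
    (index_map_conj _ _).trans S.2.1, by rw [degree_map_conj]; exact S.2.2.1, trivial⟩
  have hc1 : ∀ S, c 1 S = S := fun S => Subtype.ext (map_conj_one S.1)
  have hcm : ∀ g h S, c (g * h) S = c g (c h S) := fun g h S =>
    Subtype.ext (map_conj_mul S.1 g h)
  let ρ : TricosmModel →* Equiv.Perm X :=
    { toFun := fun g =>
        { toFun := c g
          invFun := c g⁻¹
          left_inv := fun S => by rw [← hcm, inv_mul_cancel, hc1]
          right_inv := fun S => by rw [← hcm, mul_inv_cancel, hc1] }
      map_one' := Equiv.ext hc1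
      map_mul' := fun g h => Equiv.ext (hcm g h) }
  let r : Setoid X := (Setoid.ker fun S : X => subgroupConjClass S.1)
  have hρ : ∀ g S, ((ρ g) S).1 = S.1.map (MulAut.conj g).toMonoidHom := fun _ _ => rfl
  have hB := card_orbits_of_pow_three_eq_one (ρ screw) (by
      rw [← map_pow]
      refine Equiv.ext fun S => Subtype.ext ?_
      rw [hρ]
      have hs : screw ^ 3 * 1 = (⟨0, 3⟩ : TricosmModel) := by
        ext1 <;> simp [pow_succ, screw]
      rw [mul_one] at hs
      rw [hs]
      ext y
      rw [mem_map_conj_iff]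
      change _ ↔ y ∈ S.1
      have : (⟨0, 3⟩ : TricosmModel)⁻¹ * y * ⟨0, 3⟩ = y := by
        have h1 := conj_eq (⟨0, 3⟩ : TricosmModel)⁻¹ y
        rw [inv_inv] at h1
        rw [h1]
        ext1
        · have h2 := zetaMul_zpow_of_dvd (k := -3) (by norm_num) y.base
          simp only [inv_base, inv_deg, map_zero, neg_zero, zero_add, sub_zero]
          exact h2
        · rfl
      rw [this]) r (fun S T => by
      change subgroupConjClass S.1 = subgroupConjClass T.1 ↔ _
      rw [subgroupConjClass_eq_iff]
      constructor
      · rintro ⟨g, hg⟩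
        refine ⟨g.deg, Subtype.ext ?_⟩
        rw [← map_zpow, hρ, hg]
        exact (map_conj_of_three_dvd S.2.2.1 g).symm
      · rintro ⟨j, rfl⟩
        refine ⟨screw ^ j, ?_⟩
        rw [← map_zpow, hρ])
  have hfix : Nat.card {S : X // ρ screw S = S} =
      atQuot sumTheta n 3 + 2 * atQuot sumTheta n 9 := by
    rw [← (finite_and_card_fixed hn).2]
    exact Nat.card_congr
      { toFun := fun S => ⟨S.1.1, S.1.2.1, S.1.2.2.1, Subtype.ext_iff.1 S.2⟩
        invFun := fun S => ⟨⟨S.1, S.2.1, S.2.2.1, trivial⟩, Subtype.ext S.2.2.2⟩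
        left_inv := fun _ => rfl
        right_inv := fun _ => rfl }
  have hrange : {O | ∃ S : Subgroup TricosmModel, S.index = n ∧ 3 ∣ degree S ∧
      O = subgroupConjClass S} = Set.range fun S : X => subgroupConjClass S.1 := by
    ext O
    constructor
    · rintro ⟨S, h1, h2, rfl⟩
      exact ⟨⟨S, h1, h2, trivial⟩, rfl⟩
    · rintro ⟨S, rfl⟩
      exact ⟨S.1, S.2.1, S.2.2.1, rfl⟩
  rw [hrange]
  refine ⟨Set.finite_range _, ?_⟩
  rw [hfix, hcard] at hB
  rw [← hB, ← Nat.card_coe_set_eq]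
  congr 1
  exact (Nat.card_congr (Setoid.quotientKerEquivRange _)).symm

/-! ### Conjugacy classes of the other subgroups -/

theorem zetaUnit_zpow_cases (k : ℤ) :
    (∀ a, (zetaMul ^ k) a = a) ∧ 3 ∣ k ∨ (∀ a, (zetaMul ^ k) a = zeta * a) ∧ k % 3 = 1 ∨
      (∀ a, (zetaMul ^ k) a = zeta ^ 2 * a) ∧ k % 3 = 2 := by
  rcases (by omega : k % 3 = 0 ∨ k % 3 = 1 ∨ k % 3 = 2) with h | h | h
  · exact Or.inl ⟨zetaMul_zpow_of_dvd (Int.dvd_of_emod_eq_zero h), Int.dvd_of_emod_eq_zero h⟩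
  · refine Or.inr (Or.inl ⟨fun a => ?_, h⟩)
    rw [zetaMul_zpow_apply, zetaUnit_zpow_emod, h, zpow_one]
    rfl
  · refine Or.inr (Or.inr ⟨fun a => ?_, h⟩)
    rw [zetaMul_zpow_apply, zetaUnit_zpow_emod, h]
    rfl

theorem sub_zetaMul_zpow_mem (k : ℤ) (a : EisensteinInt) :
    a - (zetaMul ^ k) a ∈ multiples (1 - zeta) := by
  rw [mem_multiples]
  rcases zetaUnit_zpow_cases k with ⟨h, -⟩ | ⟨h, -⟩ | ⟨h, -⟩ <;> rw [h]
  · simp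
  · exact ⟨a, by ring⟩
  · exact ⟨(1 + zeta) * a, by ring⟩

/-- For `3 ∤ k` the elements `1 - ζ ^ k` and `1 - ζ` are associates; when `k ≡ 2` modulo 3, `(1 - ζ
^ 2) (-ζ) = 1 - ζ`. -/
theorem exists_sub_zetaMul_zpow_eq {k : ℤ} (hk : ¬ 3 ∣ k) (r : EisensteinInt) :
    ∃ b, b - (zetaMul ^ k) b = (1 - zeta) * r := by
  rcases zetaUnit_zpow_cases k with ⟨-, h⟩ | ⟨h, -⟩ | ⟨h, -⟩
  · exact absurd h hk
  · exact ⟨r, by rw [h]; ring⟩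
  · refine ⟨-(zeta * r), ?_⟩
    rw [h]
    have : zeta ^ 2 = -1 - zeta := by decide
    linear_combination (zeta * r - r) * this

/-- Stability under `ζ ^ k` passes to `ζ ^ (k * k)`, and `k² ≡ 1` modulo 3. -/
theorem invariant_of_zpow_mem_iff {L : AddSubgroup EisensteinInt} {k : ℤ} (hk : ¬ 3 ∣ k)
    (hL : ∀ a, (zetaMul ^ k) a ∈ L ↔ a ∈ L) (a : EisensteinInt) : zeta * a ∈ L ↔ a ∈ L := by
  rw [← LinearEquiv.zpow_mul_mem_iff hL k a]
  rcases zetaUnit_zpow_cases (k * k) with ⟨-, h⟩ | ⟨h, -⟩ | ⟨-, h⟩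
  · exact absurd h fun h => hk (by rcases Int.prime_three.dvd_or_dvd h with h | h <;> exact h)
  · rw [h]
  · exfalso
    rw [Int.mul_emod] at h
    rcases (by omega : k % 3 = 0 ∨ k % 3 = 1 ∨ k % 3 = 2) with h1 | h1 | h1 <;>
      rw [h1] at h <;> norm_num at h

/-- A class is determined by `d`, the ideal `L` and `u` modulo `L + (1 - ζ)`: conjugation changes
`u` only by multiples of `1 - ζ` modulo `L`, and because `3 ∤ d` every such multiple arises as a
coboundary. -/
theorem finite_and_ncard_conjClasses_not_three_dvd {n : ℕ} (hn : 0 < n) :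
    {O | ∃ S : Subgroup TricosmModel, S.index = n ∧ ¬ 3 ∣ degree S ∧
        O = subgroupConjClass S}.Finite ∧
      {O | ∃ S : Subgroup TricosmModel, S.index = n ∧ ¬ 3 ∣ degree S ∧
        O = subgroupConjClass S}.ncard + 2 * atQuot sumTheta n 9 =
          sumTheta n + atQuot sumTheta n 3 := by
  let D : Type := ↥(n.divisors.filter (¬ 3 ∣ ·))
  let _ : Fintype D := inferInstanceAs (Fintype ↥(n.divisors.filter (¬ 3 ∣ ·)))
  have hD : ∀ d : D, d.1 ∈ n.divisors ∧ ¬ 3 ∣ d.1 := fun d => Finset.mem_filter.1 d.2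
  have hpos : ∀ d : D, 0 < d.1 := fun d => Nat.pos_of_mem_divisors (hD d).1
  have hm : ∀ d : D, 0 < n / d.1 := fun d => Nat.div_pos (Nat.divisor_le (hD d).1) (hpos d)
  let Y := Σ d : D, Σ L : InvariantSubgroup (n / d.1),
    EisensteinInt ⧸ (L.1 ⊔ multiples (1 - zeta))
  let mk : ∀ (d : D) (L : InvariantSubgroup (n / d.1)), EisensteinInt → Subgroup TricosmModel :=
    fun d L u => ofData (d.1 : ℤ) L.1 (zpow_mem_iff_of_invariant L.2.2 d.1) u
  have hcardL : ∀ (d : D) (L : InvariantSubgroup (n / d.1)),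
      Nat.card (EisensteinInt ⧸ (L.1 ⊔ multiples (1 - zeta))) =
        if 3 ∣ n / d.1 then 3 else 1 := fun d L => index_sup_multiples L
  have hfinL : ∀ (d : D) (L : InvariantSubgroup (n / d.1)),
      Finite (EisensteinInt ⧸ (L.1 ⊔ multiples (1 - zeta))) := by
    intro d L
    refine Nat.finite_of_card_ne_zero ?_
    rw [hcardL]
    split_ifs <;> norm_num
  have hfin : ∀ d : D, Finite (InvariantSubgroup (n / d.1)) := fun d =>
    finite_invariantSubgroup (hm d)
  have hcardY : Nat.card Y = ∑ d ∈ n.divisors with ¬ 3 ∣ d, cosetCount (n / d) := by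
    have h1 : ∀ d : D, Nat.card (Σ L : InvariantSubgroup (n / d.1),
        EisensteinInt ⧸ (L.1 ⊔ multiples (1 - zeta))) = cosetCount (n / d.1) := by
      intro d
      have : Fintype (InvariantSubgroup (n / d.1)) := Fintype.ofFinite _
      rw [Nat.card_sigma, Finset.sum_congr rfl fun L _ => hcardL d L, Finset.sum_const,
        smul_eq_mul, cosetCount, ← card_invariantSubgroup (hm d), Nat.card_eq_fintype_card]
      rfl
    rw [Nat.card_sigma]
    exact (Finset.sum_congr rfl fun d _ => h1 d).trans
      (Finset.sum_coe_sort (n.divisors.filter (¬ 3 ∣ ·)) fun d => cosetCount (n / d))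
  let O := {O | ∃ S : Subgroup TricosmModel, S.index = n ∧ ¬ 3 ∣ degree S ∧
        O = subgroupConjClass S}
  let Φ : Y → O := fun y => ⟨subgroupConjClass (mk y.1 y.2.1 y.2.2.out), mk y.1 y.2.1 y.2.2.out,
    by
      rw [index_ofData _ _ (hpos y.1), y.2.1.2.1]
      exact Nat.mul_div_cancel' (Nat.dvd_of_mem_divisors (hD y.1).1),
    by
      rw [degree_ofData]
      exact (hD y.1).2, rfl⟩
  have hΦ : Function.Bijective Φ := by
    constructor
    · rintro ⟨d, L, c⟩ ⟨d', L', c'⟩ h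
      have h := Subtype.ext_iff.1 h
      dsimp only [Φ] at h
      obtain ⟨g, hg⟩ := subgroupConjClass_eq_iff.1 h
      have hdd : d = d' := by
        have := congrArg degree hg
        rw [degree_map_conj, degree_ofData, degree_ofData] at this
        exact Subtype.ext this.symm
      subst hdd
      have hLL : L = L' := by
        refine Subtype.ext ?_
        ext a
        have h1 := zpow_mem_fib_map_conj (S := mk d L c.out) g (a := a)
        rw [← hg, fib_ofData _ _ (hpos d), fib_ofData _ _ (hpos d),
          zpow_mem_iff_of_invariant L'.2.2] at h1
        exact h1.symm
      subst hLL
      have hcc : c = c' := by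
        have h1 := mk_mem_map_conj g
          (mk_mem_ofData (zpow_mem_iff_of_invariant L.2.2 d.1) c.out)
        rw [← hg, mk_mem_ofData_iff _ _ (hpos d)] at h1
        rw [← QuotientAddGroup.out_eq' c, ← QuotientAddGroup.out_eq' c', QuotientAddGroup.eq]
        -- The conjugate of `(c, d)` lies in the second subgroup. Up to `L`, `c' - c` is the
        -- coboundary of `g.base` and the change of `c` under `ζ ^ g.deg`, both multiples of `1 -
        -- ζ`.
        have h2 := AddSubgroup.add_mem _
          (AddSubgroup.add_mem _ (AddSubgroup.neg_mem _ (AddSubgroup.mem_sup_left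
            (T := multiples (1 - zeta)) h1))
            (AddSubgroup.mem_sup_right (S := L.1) (sub_zetaMul_zpow_mem d.1 g.base)))
          (AddSubgroup.neg_mem _
            (AddSubgroup.mem_sup_right (S := L.1) (sub_zetaMul_zpow_mem g.deg c.out)))
        convert h2 using 1
        abel
      subst hcc
      rfl
    · rintro ⟨_, S, hS, h3, rfl⟩
      have hi := index_eq_degree_mul S
      rw [hS] at hi
      have hd0 : 0 < degree S := Nat.pos_of_ne_zero fun h => by
        rw [h, zero_mul] at hi
        omega
      let d : D := ⟨degree S, Finset.mem_filter.2
        ⟨Nat.mem_divisors.2 ⟨⟨_, hi⟩, hn.ne'⟩, h3⟩⟩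
      have h3' : ¬ (3 : ℤ) ∣ degree S := fun h => h3 (Int.natCast_dvd_natCast.1 h)
      have hfib : (fib S).index = n / degree S := by
        rw [hi, Nat.mul_div_cancel_left _ hd0]
      let L : InvariantSubgroup (n / d.1) := ⟨fib S, hfib,
        invariant_of_zpow_mem_iff h3' (zpow_natDegree_mem_fib_iff S)⟩
      obtain ⟨u, hu⟩ := exists_mem_degree S
      let c : EisensteinInt ⧸ (L.1 ⊔ multiples (1 - zeta)) := QuotientAddGroup.mk u
      refine ⟨⟨d, L, c⟩, Subtype.ext ?_⟩
      have hc : -u + c.out ∈ L.1 ⊔ multiples (1 - zeta) := by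
        rw [← QuotientAddGroup.eq, QuotientAddGroup.out_eq']
      obtain ⟨l, hl, _, hr, hlr⟩ := AddSubgroup.mem_sup.1 hc
      obtain ⟨r, rfl⟩ := mem_multiples.1 hr
      -- Conjugation by `(b, 0)` adds `(1 - ζ ^ d) b = (1 - ζ) r` to `u`, which moves it into the
      -- coset of the chosen representative modulo `L`.
      obtain ⟨b, hb⟩ := exists_sub_zetaMul_zpow_eq h3' r
      symm
      refine subgroupConjClass_eq_iff.2 ⟨⟨b, 0⟩, ?_⟩
      have hdeg := degree_map_conj (S := S) (⟨b, 0⟩ : TricosmModel)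
      have hfib' : fib (S.map (MulAut.conj (⟨b, 0⟩ : TricosmModel)).toMonoidHom) = fib S := by
        ext a
        have := zpow_mem_fib_map_conj (S := S) (⟨b, 0⟩ : TricosmModel) (a := a)
        rwa [zpow_zero] at this
      refine (ofData_eq_iff _ _ (hpos d) hdeg).2 ⟨hfib', ?_⟩
      have h1 := mk_mem_map_conj (⟨b, 0⟩ : TricosmModel) hu
      refine (sub_mem_fib h1).2 ?_
      rw [hfib']
      convert hl using 1
      simp only [zpow_zero, LinearEquiv.coe_one, id_eq]
      linear_combination -hlr - hb
  have : Finite O := Finite.of_surjective Φ hΦ.2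
  refine ⟨Set.toFinite O, ?_⟩
  rw [← sum_cosetCount_not_three_dvd, ← hcardY, Nat.card_congr (Equiv.ofBijective Φ hΦ),
    Nat.card_coe_set_eq]

end TricosmModel

/-! ### Transport to the fundamental group -/

theorem map_subgroupConjClass {G H : Type*} [Group G] [Group H] (e : G ≃* H) (S : Subgroup G) :
    e.mapSubgroup '' subgroupConjClass S = subgroupConjClass (e.mapSubgroup S) := by
  have h : ∀ g : G, e.mapSubgroup (S.map (MulAut.conj g).toMonoidHom) =
      (e.mapSubgroup S).map (MulAut.conj (e g)).toMonoidHom := by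
    intro g
    change (S.map _).map _ = (S.map _).map _
    rw [Subgroup.map_map, Subgroup.map_map]
    congr 1
    ext x
    simp
  ext T
  constructor
  · rintro ⟨_, ⟨g, rfl⟩, rfl⟩
    exact ⟨e g, h g⟩
  · rintro ⟨k, rfl⟩
    obtain ⟨g, rfl⟩ := e.surjective k
    exact ⟨_, ⟨g, rfl⟩, h g⟩

theorem image_conjClassesOfType {K : Type*} [Group K] {G H : Type*} [Group G] [Group H]
    (e : G ≃* H) (n : ℕ) :
    (fun O => e.mapSubgroup '' O) '' conjClassesOfType K G n = conjClassesOfType K H n := by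
  ext O
  constructor
  · rintro ⟨_, ⟨S, hS, ⟨f⟩, rfl⟩, rfl⟩
    exact ⟨e.mapSubgroup S, (Subgroup.index_map_equiv S e).trans hS,
      ⟨(e.subgroupMap S).symm.trans f⟩, map_subgroupConjClass e S⟩
  · rintro ⟨T, hT, ⟨f⟩, rfl⟩
    obtain ⟨S, rfl⟩ := e.mapSubgroup.surjective T
    exact ⟨_, ⟨S, (Subgroup.index_map_equiv S e).symm.trans hT, ⟨(e.subgroupMap S).trans f⟩, rfl⟩,
      map_subgroupConjClass e S⟩

theorem conjClassesOfType_finite_and_ncard {K : Type*} [Group K] {G H : Type*} [Group G]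
    [Group H] (e : G ≃* H) (n : ℕ) :
    ((conjClassesOfType K H n).Finite → (conjClassesOfType K G n).Finite) ∧
      (conjClassesOfType K G n).ncard = (conjClassesOfType K H n).ncard := by
  have hinj : Function.Injective fun O : Set (Subgroup G) => e.mapSubgroup '' O :=
    Set.image_injective.2 e.mapSubgroup.injective
  rw [← image_conjClassesOfType e n]
  exact ⟨fun h => h.of_finite_image hinj.injOn, (Set.ncard_image_of_injective _ hinj).symm⟩

theorem conjClassesOfType_congr {K K' : Type*} [Group K] [Group K'] (e : K ≃* K') (G : Type*)
    [Group G] (n : ℕ) : conjClassesOfType K G n = conjClassesOfType K' G n := by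
  ext O
  refine exists_congr fun S => and_congr_right fun _ => and_congr_left fun _ => ?_
  exact ⟨fun ⟨f⟩ => ⟨f.trans e⟩, fun ⟨f⟩ => ⟨f.trans e.symm⟩⟩

namespace TricosmModel

theorem finite_and_card_coveringClasses {n : ℕ} (hn : 0 < n) (M : Type) [TopologicalSpace M]
    {P : Subgroup TricosmModel → Prop}
    (hP : ∀ S : Subgroup TricosmModel, S.index ≠ 0 →
      (Nonempty (Quotient (MulAction.orbitRel S (ℂ × ℝ)) ≃ₜ M) ↔ P S))
    (hfin : {O | ∃ S : Subgroup TricosmModel, S.index = n ∧ P S ∧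
      O = subgroupConjClass S}.Finite) :
    Finite (CoveringClasses.{u} Tricosm n M) ∧ Nat.card (CoveringClasses.{u} Tricosm n M) =
      {O | ∃ S : Subgroup TricosmModel, S.index = n ∧ P S ∧ O = subgroupConjClass S}.ncard := by
  obtain ⟨e⟩ := isQuotientCoveringMap_tricosm.nonempty_coveringClasses_equiv.{u} n M
  have h : {O : Set (Subgroup TricosmModel) | ∃ S : Subgroup TricosmModel, S.index = n ∧
      Nonempty (Quotient (MulAction.orbitRel S (ℂ × ℝ)) ≃ₜ M) ∧ O = subgroupConjClass S} =
      {O | ∃ S : Subgroup TricosmModel, S.index = n ∧ P S ∧ O = subgroupConjClass S} := by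
    ext O
    refine exists_congr fun S => and_congr_right fun hS => and_congr_left fun _ => ?_
    exact hP S (by omega)
  rw [h] at e
  have := hfin.to_subtype
  exact ⟨Finite.of_equiv _ e.symm, (Nat.card_congr e).trans (Nat.card_coe_set_eq _)⟩

theorem conjClassesOfType_eq {K : Type*} [Group K] {n : ℕ} (hn : 0 < n)
    {P : Subgroup TricosmModel → Prop}
    (hP : ∀ S : Subgroup TricosmModel, S.index ≠ 0 → (Nonempty (S ≃* K) ↔ P S)) :
    conjClassesOfType K TricosmModel n =
      {O | ∃ S : Subgroup TricosmModel, S.index = n ∧ P S ∧ O = subgroupConjClass S} := by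
  ext O
  refine exists_congr fun S => and_congr_right fun hS => and_congr_left fun _ => ?_
  exact hP S (by omega)

end TricosmModel

/-! ### The theorem: classification and counts combined. -/

open TricosmModel in
theorem theorem2 (n : ℕ) (hn : 0 < n) :
    -- the homeomorphism type of an `n`-fold covering
    (∀ c : NFoldCovering.{u} Tricosm n,
      (¬ 3 ∣ n → Nonempty (c.Total ≃ₜ Tricosm)) ∧
      (3 ∣ n → Nonempty (c.Total ≃ₜ Tricosm) ∨ Nonempty (c.Total ≃ₜ Torus3))) ∧
    -- the numbers of nonequivalent coverings of each type
    (Finite (CoveringClasses.{u} Tricosm n Tricosm) ∧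
      (Nat.card (CoveringClasses.{u} Tricosm n Tricosm) : ℚ) =
        (sumTheta n : ℚ) + (atQuot sumTheta n 3 : ℚ) - 2 * (atQuot sumTheta n 9 : ℚ)) ∧
    (Finite (CoveringClasses.{u} Tricosm n Torus3) ∧
      (Nat.card (CoveringClasses.{u} Tricosm n Torus3) : ℚ) =
        1 / 3 * ((atQuot omegaFun n 3 : ℚ) + 2 * (atQuot sumTheta n 3 : ℚ)
          + 4 * (atQuot sumTheta n 9 : ℚ))) ∧
    -- the numbers of conjugacy classes of subgroups of each type in the fundamental group
    (∀ x : Tricosm,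
      ((conjClassesOfType (FundamentalGroup Tricosm x) (FundamentalGroup Tricosm x) n).Finite ∧
        ((conjClassesOfType (FundamentalGroup Tricosm x)
            (FundamentalGroup Tricosm x) n).ncard : ℚ) =
          (sumTheta n : ℚ) + (atQuot sumTheta n 3 : ℚ) - 2 * (atQuot sumTheta n 9 : ℚ)) ∧
      ((conjClassesOfType (Multiplicative (Fin 3 → ℤ)) (FundamentalGroup Tricosm x) n).Finite ∧
        ((conjClassesOfType (Multiplicative (Fin 3 → ℤ))
            (FundamentalGroup Tricosm x) n).ncard : ℚ) =
          1 / 3 * ((atQuot omegaFun n 3 : ℚ) + 2 * (atQuot sumTheta n 3 : ℚ)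
            + 4 * (atQuot sumTheta n 9 : ℚ)))) := by
  obtain ⟨hf1, hc1⟩ := finite_and_ncard_conjClasses_not_three_dvd hn
  obtain ⟨hf2, hc2⟩ := finite_and_ncard_conjClasses_three_dvd hn
  set N := {O | ∃ S : Subgroup TricosmModel, S.index = n ∧ ¬ 3 ∣ degree S ∧
        O = subgroupConjClass S}
  set T := {O | ∃ S : Subgroup TricosmModel, S.index = n ∧ 3 ∣ degree S ∧
        O = subgroupConjClass S}
  have hN : (N.ncard : ℚ) =
      (sumTheta n : ℚ) + (atQuot sumTheta n 3 : ℚ) - 2 * (atQuot sumTheta n 9 : ℚ) := by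
    rw [eq_sub_iff_add_eq]
    exact_mod_cast hc1
  have hT : (T.ncard : ℚ) = 1 / 3 * ((atQuot omegaFun n 3 : ℚ) + 2 * (atQuot sumTheta n 3 : ℚ)
      + 4 * (atQuot sumTheta n 9 : ℚ)) := by
    have : (T.ncard : ℚ) * 3 = (atQuot omegaFun n 3 : ℚ) + 2 * ((atQuot sumTheta n 3 : ℚ)
        + 2 * (atQuot sumTheta n 9 : ℚ)) := by exact_mod_cast hc2
    linarith
  refine ⟨fun c => ?_, ?_, ?_, fun x => ⟨?_, ?_⟩⟩
  · obtain ⟨S, h, hS⟩ := isQuotientCoveringMap_tricosm.exists_subgroup_homeomorph c.isCoveringMap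
    have hSn : S.index = n := by
      let x : Tricosm := Quotient.mk _ 0
      rw [← isQuotientCoveringMap_tricosm.card_fiber_subgroupProj S x, ← c.card_fiber x]
      refine Nat.card_congr (h.toEquiv.subtypeEquiv fun y => ?_)
      rw [hS]
      rfl
    have hS0 : S.index ≠ 0 := by omega
    -- Thus `3 ∤ n` rules out `3 ∣ degree S`, the toral case.
    have hdvd : degree S ∣ n := ⟨_, hSn.symm.trans (index_eq_degree_mul S)⟩
    have key : ¬ 3 ∣ degree S → Nonempty (c.Total ≃ₜ Tricosm) := fun h3 => by
      obtain ⟨k⟩ := (nonempty_homeomorph_tricosm_iff hS0).2 h3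
      exact ⟨h.symm.trans k⟩
    refine ⟨fun h3 => key fun h => h3 (h.trans hdvd), fun _ => ?_⟩
    by_cases h3 : 3 ∣ degree S
    · obtain ⟨k⟩ := (nonempty_homeomorph_torus_iff hS0).2 h3
      exact Or.inr ⟨h.symm.trans k⟩
    · exact Or.inl (key h3)
  · obtain ⟨h1, h2⟩ := finite_and_card_coveringClasses.{u} hn Tricosm
      (fun S hS => nonempty_homeomorph_tricosm_iff hS) hf1
    exact ⟨h1, by rw [h2, hN]⟩
  · obtain ⟨h1, h2⟩ := finite_and_card_coveringClasses.{u} hn Torus3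
      (fun S hS => nonempty_homeomorph_torus_iff hS) hf2
    exact ⟨h1, by rw [h2, hT]⟩
  · obtain ⟨e⟩ := nonempty_fundamentalGroup_mulEquiv x
    obtain ⟨h1, h2⟩ := conjClassesOfType_finite_and_ncard (K := TricosmModel) e n
    have h3 := conjClassesOfType_eq hn fun S hS => nonempty_mulEquiv_self_iff (S := S) hS
    rw [conjClassesOfType_congr e]
    rw [h3] at h1 h2
    exact ⟨h1 hf1, by rw [h2, hN]⟩
  · obtain ⟨e⟩ := nonempty_fundamentalGroup_mulEquiv x
    obtain ⟨h1, h2⟩ := conjClassesOfType_finite_and_ncard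
      (K := Multiplicative (Fin 3 → ℤ)) e n
    have h3 := conjClassesOfType_eq hn fun S hS => nonempty_mulEquiv_int_iff (S := S) hS
    rw [h3] at h1 h2
    exact ⟨h1 hf2, by rw [h2, hT]⟩
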